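/- **Setting.** A *network* is a finite directed graph without self-loops; an *automorphism* of a network is an edge-preserving permutation of its vertices. A *system* on a network $G'=(V',E')$ consists of one sequential CSP program for each vertex, built from local statements, synchronous send and receive statements, and non-deterministic selection and repetition over guarded commands; a guard is a Boolean expression over local variables, optionally followed by a communication. $G'$ *admits* the system if $(v,w)\in E'$ whenever the program of $v$ contains an output command to $w$ or the program of $w$ contains an input command from $v$. The system is in $\mathrm{CSP}_{in}$ if no output command occurs in a guard. A *computation* is a maximal sequence of valid steps from the initial state (each step is a local step of one process or a joint send/receive step of two processes); it is *properly terminated* if it is finite and at its end all processes have completed their programs. A *peer-to-peer network* is a network $G=(V,E)$ with at least two vertices such that $G$ is strongly connected; for all distinct $a,b\in V$ we have $(a,b)\in E$ or $(b,a)\in E$; and $G$ has an automorphism $\sigma\neq\mathrm{id}$ such that, for all $p\ge 0$, $\sigma^p(v)=v$ for some $v\in V$ implies $\sigma^p=\mathrm{id}$. A network $G'=(V',E')$ is a *symmetry-preserving extension* of $G$ by means of a partition $\{S_v\}_{v\in V}$ of $V'$ if (i) $v\in S_v$ for all $v\in V$; (ii) for all $v\in V$ and $v'\in S_v\setminus\{v\}$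 there are paths in $G'$ from $v$ to $v'$ and from $v'$ to $v$; (iii) for all distinct $v,w\in V$, $E'\cap(S_v\times S_w)\neq\emptyset$ if and only if $(v,w)\in E$; (iv) each automorphism $\sigma$ of $G$ extends to an automorphism $\iota_\sigma$ of $G'$ with $\iota_\sigma(S_v)=S_{\sigma(v)}$ for all $v\in V$. A system on such a $G'$ is *$G$-symmetric* (with respect to $\{S_v\}_{v\in V}$) if for each automorphism $\sigma$ of $G'$ with $\sigma(V)=V$ and $\sigma(S_v)=S_{\sigma(v)}$ for all $v\in V$, and each computation $C$ of the system, there is a computation $C'$ of the system in which, for each $v\in V'$, the process at $\sigma(v)$ performs the same steps as the process at $v$ does in $C$, modulo changing the process names that occur via $\sigma$. A system *pairwise synchronizes* $V$ if all its computations are properly terminated and contain, for each pair of distinct $a,b\in V$, at least one direct communication from $a$ to $b$ or from $b$ to $a$. A system is *electoral* if all its computations are properly terminated and at the time of termination the local variables $\mathit{leader}$ of all processes contain the same value, namely the name of some process of the system. **Lemma.** Let $G=(V,E)$ be a peer-to-peer network and let $G'$ be a symmetry-preserving extension of $G$ by means of $\{S_v\}_{v\in V}$. If $G'$ admits a $G$-symmetric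 system in $\mathrm{CSP}_{in}$ that pairwise synchronizes $V$, then $G'$ admits a $G$-symmetric electoral system in $\mathrm{CSP}_{in}$. -/

import Mathlib

/-! ### Directed graphs -/

namespace Network

/-- An automorphism of a (finite) directed graph: a permutation of the vertices preserving edges. -/
def IsAut {N : Type*} (G : Digraph N) (σ : Equiv.Perm N) : Prop :=
  ∀ v w, G.Adj v w → G.Adj (σ v) (σ w)

/-- A power of `σ` that fixes some vertex is the identity (all orbits have the same size). -/
def IsWellBalanced {N : Type*} (σ : Equiv.Perm N) : Prop :=
  ∀ p : ℕ, (∃ v, (σ ^ p) v = v) → σ ^ p = 1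

/-- There are directed paths from `a` to `b` and from `b` to `a`. -/
def StronglyConn {N : Type*} (G : Digraph N) (a b : N) : Prop :=
  Relation.ReflTransGen G.Adj a b ∧ Relation.ReflTransGen G.Adj b a

/-- A peer-to-peer network (finiteness of the vertex set is assumed where this is used). -/
structure IsPeerToPeer {V : Type*} (G : Digraph V) : Prop where
  loopless : ∀ v, ¬ G.Adj v v
  two_vertices : Nontrivial V
  strongly_connected : ∀ a b, StronglyConn G a b
  directly_connected : ∀ a b, a ≠ b → G.Adj a b ∨ G.Adj b a
  well_balanced : ∃ σ : Equiv.Perm V, IsAut G σ ∧ IsWellBalanced σ ∧ σ ≠ 1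

/-- The network `G'` on the vertex set `N` is a symmetry-preserving extension of the network `G`
on `V ⊆ N`, by means of the collection `S` of subsets of `N`. -/
structure IsSymmExtension {N : Type*} (V : Set N) (G : Digraph V) (G' : Digraph N)
    (S : V → Set N) : Prop where
  loopless : ∀ v, ¬ G'.Adj v v
  /-- the sets `S v` partition the vertices of `G'` -/
  partition : ∀ x : N, ∃! v : V, x ∈ S v
  self_mem : ∀ v : V, (v : N) ∈ S v
  conn : ∀ v : V, ∀ v' ∈ S v, v' ≠ v → StronglyConn G' v v'
  /-- links between different processors exist exactly where `G` has an edge;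
  links inside one processor are unrestricted -/
  inter : ∀ v w : V, v ≠ w → ((∃ x ∈ S v, ∃ y ∈ S w, G'.Adj x y) ↔ G.Adj v w)
  extend : ∀ σ : Equiv.Perm V, IsAut G σ → ∃ ι : Equiv.Perm N, IsAut G' ι ∧
    (∀ v : V, ι v = σ v) ∧ ∀ v : V, ι '' S v = S (σ v)

/-- The automorphisms of `G'` that matter for `G`-symmetry: they keep the set `V` of main vertices
invariant and map the processor of `v` onto the processor of the image of `v`. -/
def Respects {N : Type*} (V : Set N) (S : V → Set N) (σ : Equiv.Perm N) : Prop :=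
  σ '' V = V ∧ ∀ v w : V, σ v = w → σ '' S v = S w

end Network

/-! ### Communicating sequential processes with names in `N` -/

namespace CSP

/-- Names of local variables; they may be indexed by names, like `sync_w`. -/
structure Var (N : Type*) where
  ident : ℕ
  index : List N

/-- Data values; `unset` is the content of a variable that has not been written. -/
inductive Val (N : Type*)
  | unset : Val N
  | bool : Bool → Val N
  | num : ℤ → Val N
  | name : N → Val N
  | pair : Val N → Val N → Val N

/-- The contents of the local variables of one process. -/
abbrev Store (N : Type*) := Var N → Val N

/-- Communication part of a guard: none, input from `w` into `x`, or output to `w`. -/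
inductive GuardComm (N : Type*)
  | none : GuardComm N
  | input (w : N) (x : Var N) : GuardComm N
  | output (w : N) (e : Store N → Val N) : GuardComm N

/-- A guard: a Boolean expression, optionally followed by a communication. -/
structure Guard (N : Type*) where
  cond : Store N → Bool
  comm : GuardComm N

/-- Statements of sequential programs. A program is a list of statements. -/
inductive Stmt (N : Type*)
  | skip : Stmt N
  | assign (x : Var N) (e : Store N → Val N) : Stmt N
  | send (w : N) (e : Store N → Val N) : Stmt N
  | recv (w : N) (x : Var N) : Stmt N
  /-- non-deterministic selection -/
  | sel (bs : List (Guard N × List (Stmt N))) : Stmt N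
  /-- non-deterministic repetition -/
  | rep (bs : List (Guard N × List (Stmt N))) : Stmt N

abbrev Prog (N : Type*) := List (Stmt N)

/-- The statement `t` occurs in a program, possibly nested in control structures. -/
inductive Occurs {N : Type*} (t : Stmt N) : Prog N → Prop
  | here {p : Prog N} : t ∈ p → Occurs t p
  | in_sel {p : Prog N} {bs : List (Guard N × Prog N)} {b : Guard N × Prog N} :
      Stmt.sel bs ∈ p → b ∈ bs → Occurs t b.2 → Occurs t p
  | in_rep {p : Prog N} {bs : List (Guard N × Prog N)} {b : Guard N × Prog N} :
      Stmt.rep bs ∈ p → b ∈ bs → Occurs t b.2 → Occurs t p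

/-- The guard `g` occurs in a control structure of the program. -/
def GuardOccurs {N : Type*} (g : Guard N) (p : Prog N) : Prop :=
  ∃ (bs : List (Guard N × Prog N)) (c : Prog N), (g, c) ∈ bs ∧
    (Occurs (Stmt.sel bs) p ∨ Occurs (Stmt.rep bs) p)

/-- The program contains an output command (statement or guard) to `w`. -/
def ContainsOutput {N : Type*} (p : Prog N) (w : N) : Prop :=
  (∃ e, Occurs (Stmt.send w e) p) ∨ ∃ g e, GuardOccurs g p ∧ g.comm = GuardComm.output w e

/-- The program contains an input command (statement or guard) from `w`. -/
def ContainsInput {N : Type*} (p : Prog N) (w : N) : Prop :=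
  (∃ x, Occurs (Stmt.recv w x) p) ∨ ∃ g x, GuardOccurs g p ∧ g.comm = GuardComm.input w x

/-- Execution position: about to run a list of statements, or suspended in a control structure
whose Boolean guards have been evaluated, with the remaining (not closed) branches `bs` and the
program `k` to run after the chosen branch. -/
inductive Pos (N : Type*)
  | run (k : Prog N) : Pos N
  | await (bs : List (Guard N × Prog N)) (k : Prog N) : Pos N

/-- State of one process. -/
structure PState (N : Type*) where
  pos : Pos N
  store : Store N

/-- What one process does in one step. -/
inductive Action (N : Type*)
  | skip : Action N
  | assign (x : Var N) (d : Val N) : Action N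
  /-- evaluate the Boolean guards, at least one of which is true -/
  | guards : Action N
  /-- evaluate the Boolean guards of a repetition, all false, and exit it -/
  | exit : Action N
  /-- enter a branch whose guard has no communication -/
  | choose : Action N
  | send (w : N) (d : Val N) : Action N
  | recv (w : N) (x : Var N) (d : Val N) : Action N

/-- The action involves no other process. -/
def Action.IsLocal {N : Type*} : Action N → Prop
  | .send _ _ => False
  | .recv _ _ _ => False
  | _ => True

open Classical in
/-- Write the value `d` into the variable `x`. -/
noncomputable def Store.write {N : Type*} (s : Store N) (x : Var N) (d : Val N) : Store N :=
  Function.update s x d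

/-- The branches whose Boolean guard is true. -/
def notClosed {N : Type*} (s : Store N) (bs : List (Guard N × Prog N)) :
    List (Guard N × Prog N) :=
  bs.filter fun b => b.1.cond s

/-- Steps of one process. A selection all of whose guards are closed fails: it has no step. -/
inductive PStep {N : Type*} : PState N → Action N → PState N → Prop
  | skip (k : Prog N) (s : Store N) :
      PStep ⟨.run (.skip :: k), s⟩ .skip ⟨.run k, s⟩
  | assign (x : Var N) (e : Store N → Val N) (k : Prog N) (s : Store N) :
      PStep ⟨.run (.assign x e :: k), s⟩ (.assign x (e s)) ⟨.run k, s.write x (e s)⟩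
  | send (w : N) (e : Store N → Val N) (k : Prog N) (s : Store N) :
      PStep ⟨.run (.send w e :: k), s⟩ (.send w (e s)) ⟨.run k, s⟩
  | recv (w : N) (x : Var N) (d : Val N) (k : Prog N) (s : Store N) :
      PStep ⟨.run (.recv w x :: k), s⟩ (.recv w x d) ⟨.run k, s.write x d⟩
  | sel (bs : List (Guard N × Prog N)) (k : Prog N) (s : Store N) :
      notClosed s bs ≠ [] →
      PStep ⟨.run (.sel bs :: k), s⟩ .guards ⟨.await (notClosed s bs) k, s⟩
  | rep (bs : List (Guard N × Prog N)) (k : Prog N) (s : Store N) :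
      notClosed s bs ≠ [] →
      PStep ⟨.run (.rep bs :: k), s⟩ .guards ⟨.await (notClosed s bs) (.rep bs :: k), s⟩
  | exit (bs : List (Guard N × Prog N)) (k : Prog N) (s : Store N) :
      notClosed s bs = [] →
      PStep ⟨.run (.rep bs :: k), s⟩ .exit ⟨.run k, s⟩
  | choose (bs : List (Guard N × Prog N)) (k : Prog N) (s : Store N)
      (b : Guard N × Prog N) : b ∈ bs → b.1.comm = .none →
      PStep ⟨.await bs k, s⟩ .choose ⟨.run (b.2 ++ k), s⟩
  | guard_recv (bs : List (Guard N × Prog N)) (k : Prog N) (s : Store N)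
      (b : Guard N × Prog N) (w : N) (x : Var N) (d : Val N) :
      b ∈ bs → b.1.comm = .input w x →
      PStep ⟨.await bs k, s⟩ (.recv w x d) ⟨.run (b.2 ++ k), s.write x d⟩
  | guard_send (bs : List (Guard N × Prog N)) (k : Prog N) (s : Store N)
      (b : Guard N × Prog N) (w : N) (e : Store N → Val N) :
      b ∈ bs → b.1.comm = .output w e →
      PStep ⟨.await bs k, s⟩ (.send w (e s)) ⟨.run (b.2 ++ k), s⟩

/-- A system: one program for each name. -/
abbrev System (N : Type*) := N → Prog N

/-- State of a system. -/
abbrev SState (N : Type*) := N → PState N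

/-- Initially every process is at the start of its program and no variable has been written. -/
def System.init {N : Type*} (P : System N) : SState N :=
  fun v => ⟨.run (P v), fun _ => .unset⟩

/-- What happens in one computation step: a local step of `v`, or a message `d` from `v` to the
variable `x` of `w`. -/
inductive Event (N : Type*)
  | loc (v : N) (a : Action N) : Event N
  | comm (v w : N) (x : Var N) (d : Val N) : Event N

open Classical in
/-- Valid computation steps. -/
inductive SStep {N : Type*} : SState N → Event N → SState N → Prop
  | loc (s : SState N) (v : N) (a : Action N) (t : PState N) :
      a.IsLocal → PStep (s v) a t → SStep s (.loc v a) (Function.update s v t)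
  | comm (s : SState N) (v w : N) (x : Var N) (d : Val N) (t u : PState N) :
      v ≠ w → PStep (s v) (.send w d) t → PStep (s w) (.recv v x d) u →
      SStep s (.comm v w x d) (Function.update (Function.update s v t) w u)

/-- A computation: a maximal sequence of valid computation steps from the initial state. The value
`event n = none` means that the sequence has ended before the `n`-th step (counting from zero),
which is the case only if no step is possible; the state is then repeated forever. -/
structure Computation {N : Type*} (P : System N) where
  state : ℕ → SState N
  event : ℕ → Option (Event N)
  start : state 0 = P.init
  next : ∀ n e, event n = some e → SStep (state n) e (state (n + 1))
  ended : ∀ n, event n = none → (∀ e t, ¬ SStep (state n) e t) ∧ state (n + 1) = state n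

/-- All processes have completed their last instruction. -/
def Finished {N : Type*} (s : SState N) : Prop := ∀ v, (s v).pos = .run []

/-- The computation is finite and ends with all processes having completed their programs. -/
def Computation.ProperlyTerminated {N : Type*} {P : System N} (C : Computation P) : Prop :=
  ∃ n, C.event n = none ∧ Finished (C.state n)

open Classical in
/-- The action of process `u` in an event, if it takes part in it. -/
noncomputable def Event.actionOf {N : Type*} (u : N) : Event N → Option (Action N)
  | .loc v a => if u = v then some a else none
  | .comm v w x d =>
      if u = v then some (.send w d) else if u = w then some (.recv v x d) else none

/-- The list of the actions of process `v` in the first `n` steps of a computation. -/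
noncomputable def Computation.hist {N : Type*} {P : System N} (C : Computation P) (v : N) :
    ℕ → List (Action N)
  | 0 => []
  | n + 1 => C.hist v n ++ ((C.event n).bind (Event.actionOf v)).toList

/-! Renaming of processes -/

def Var.rename {N : Type*} (σ : Equiv.Perm N) (x : Var N) : Var N :=
  ⟨x.ident, x.index.map σ⟩

def Val.rename {N : Type*} (σ : Equiv.Perm N) : Val N → Val N
  | .unset => .unset
  | .bool b => .bool b
  | .num n => .num n
  | .name v => .name (σ v)
  | .pair a b => .pair (a.rename σ) (b.rename σ)

def Action.rename {N : Type*} (σ : Equiv.Perm N) : Action N → Action N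
  | .skip => .skip
  | .assign x d => .assign (x.rename σ) (d.rename σ)
  | .guards => .guards
  | .exit => .exit
  | .choose => .choose
  | .send w d => .send (σ w) (d.rename σ)
  | .recv w x d => .recv (σ w) (x.rename σ) (d.rename σ)

/-- In `C'` each process `σ v` performs the same (finite or infinite) sequence of actions as `v` in
`C`, up to renaming by `σ`: the two sequences have the same finite prefixes. -/
def SameSteps {N : Type*} {P : System N} (σ : Equiv.Perm N) (C C' : Computation P) : Prop :=
  ∀ v, Set.range (C'.hist (σ v)) = (List.map (Action.rename σ)) '' Set.range (C.hist v)

/-! ### Properties of systems -/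

/-- The network `G` admits the system `P`. -/
def System.AdmittedBy {N : Type*} (P : System N) (G : Digraph N) : Prop :=
  ∀ v w, (ContainsOutput (P v) w ∨ ContainsInput (P w) v) → G.Adj v w

/-- The dialect with input guards only: no output command appears in a guard. -/
def System.InCSPin {N : Type*} (P : System N) : Prop :=
  ∀ v g, GuardOccurs g (P v) → ∀ w e, g.comm ≠ .output w e

/-- `G`-symmetry of a system with communication graph `G'`, where `G'` is an extension of a network
on `V` by means of the collection `S`. -/
def System.IsGSymmetric {N : Type*} (P : System N) (V : Set N) (G' : Digraph N)
    (S : V → Set N) : Prop :=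
  ∀ σ : Equiv.Perm N, Network.IsAut G' σ → Network.Respects V S σ →
    ∀ C : Computation P, ∃ C' : Computation P, SameSteps σ C C'

/-- The system pairwise synchronizes the set `Q` of processes. -/
def System.Synchronizes {N : Type*} (P : System N) (Q : Set N) : Prop :=
  ∀ C : Computation P, C.ProperlyTerminated ∧
    ∀ a ∈ Q, ∀ b ∈ Q, a ≠ b →
      ∃ n x d, C.event n = some (.comm a b x d) ∨ C.event n = some (.comm b a x d)

/-- The variable `leader`. -/
def leader {N : Type*} : Var N := ⟨0, []⟩

/-- Electoral systems: every computation terminates properly, with the variables `leader` of all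
processes containing the same process name. -/
def System.IsElectoral {N : Type*} (P : System N) : Prop :=
  ∀ C : Computation P, ∃ n, C.event n = none ∧ Finished (C.state n) ∧
    ∃ w : N, ∀ v, (C.state n v).store leader = .name w

end CSP

/-!
# Pairwise synchronization yields symmetric leader election

Let `P` be the given symmetric system that pairwise synchronizes `V`. The leader is found in a
knock-out tournament played on top of an execution of `P`. In the beginning the processes of `V`
are alive. The processes execute `P`, each message also tells whether its sender is alive, and a
message from a process that is alive makes the receiver dead. There is always a process that is
alive (`exists_alive`), and a process that has completed its part of `P` while alive has
communicated with all other processes of `V`, so that it is the only one alive (`eq_of_alive`). It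
becomes the leader. It then sends its name as a token along a walk that visits all vertices; such
a walk exists (`exists_route`) since the extension of a strongly connected network is strongly
connected (`Network.IsSymmExtension.reflTransGen`). A process stops when the token leaves it for
the last time.

The protocol `election` does not run the text of `P`: this text need not be symmetric, only the
set of computations is. Processes are instead guided by the possible lists of their actions in
complete executions of `P`. The following facts make this equivalent to an execution of `P`.

* An execution is determined by its projections to the single processes (`path_of_proj`). So a
  process may decide on its next local action or output without regard to the others, and symmetry
  of `P` means that complete executions may be renamed (`complete_rename`). In particular the sets
  of possible lists of actions are symmetric.
* As `P` is in the dialect with input guards only, a process that can output cannot do anything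
  else (`eq_of_send`). So a process that decides on an output does not give up an input it might
  need, and no output of `P` is ever addressed to a process that has finished
  (`not_fullTrace_of_send`). The token can be received whenever a process of the protocol waits
  for a message. A deadlock of the protocol within `P` is thus a deadlock of `P`, which is
  excluded (`ElectionInv.stuck`).
* By König's lemma the lengths of the executions of `P` are bounded (`exists_length_bound`), which
  gives the measure for the termination of the protocol.

The protocol is an abstract `Machine`, in which the new state after a step is only specified by a
relation; for instance, the route of the token may be any walk through all vertices. The program
of the language that implements it (`Machine.toSystem`) is a single loop that reads the encoded
state of the machine from a variable and offers one guarded branch for each possible move. Its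
expressions are deterministic, and a choice of one new state for each step could violate symmetry.
Symmetry is saved by non-determinism: for each symmetry `τ` of the network there is a branch that
uses the choice conjugated by `τ`, and renaming by `σ` maps the branch of `τ` to the branch of
`σ * τ` (`Machine.pickInner_mul`, `Machine.complete_rename_toSystem`). That the program elects a
leader follows from an invariant and a measure of the machine (`Machine.toSystem_isElectoral`).
-/

namespace CSP

/-! ### Labelled paths, and system paths as products of process paths -/

/-- `Path R s l t`: the labelled transition relation `R` leads from `s` to `t` by steps with the
labels `l`. -/
inductive Path {α β : Type*} (R : α → β → α → Prop) : α → List β → α → Prop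
  | nil (s : α) : Path R s [] s
  | cons {s t u : α} {a : β} {l : List β} : R s a t → Path R t l u → Path R s (a :: l) u

namespace Path

variable {α β : Type*} {R : α → β → α → Prop}

theorem single {s t : α} {a : β} (h : R s a t) : Path R s [a] t := cons h (nil t)

theorem append {s t u : α} {l m : List β} (h : Path R s l t) (h' : Path R t m u) :
    Path R s (l ++ m) u := by
  induction h with
  | nil => exact h'
  | cons h₁ _ ih => exact cons h₁ (ih h')

theorem split {l m : List β} : ∀ {s u : α}, Path R s (l ++ m) u →
    ∃ t, Path R s l t ∧ Path R t m u := by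
  induction l with
  | nil => exact fun h => ⟨_, nil _, h⟩
  | cons a l ih =>
    rintro s u (_ | ⟨h₁, h₂⟩)
    obtain ⟨t, ht, hm⟩ := ih h₂
    exact ⟨t, cons h₁ ht, hm⟩

theorem nil_iff {s t : α} : Path R s [] t ↔ t = s :=
  ⟨fun h => by cases h; rfl, fun h => h ▸ nil _⟩

theorem cons_iff {s u : α} {a : β} {l : List β} :
    Path R s (a :: l) u ↔ ∃ t, R s a t ∧ Path R t l u :=
  ⟨fun h => by cases h with | cons h₁ h₂ => exact ⟨_, h₁, h₂⟩, fun ⟨_, h₁, h₂⟩ => cons h₁ h₂⟩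

theorem concat_iff {s u : α} {a : β} {l : List β} :
    Path R s (l ++ [a]) u ↔ ∃ t, Path R s l t ∧ R t a u := by
  constructor
  · intro h
    obtain ⟨t, ht, hu⟩ := split h
    obtain ⟨u', hu', h'⟩ := cons_iff.1 hu
    rw [nil_iff] at h'
    exact ⟨t, ht, h' ▸ hu'⟩
  · rintro ⟨t, ht, hu⟩
    exact ht.append (single hu)

end Path

variable {N : Type*}

/-- The actions of process `v` in a list of events. -/
noncomputable def proj (v : N) (es : List (Event N)) : List (Action N) :=
  es.filterMap (Event.actionOf v)

/-- The side conditions that `SStep` puts on an event. -/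
def Event.WF : Event N → Prop
  | .loc _ a => a.IsLocal
  | .comm v w _ _ => v ≠ w

@[simp] theorem proj_nil (v : N) : proj v [] = [] := rfl

theorem proj_append (v : N) (es es' : List (Event N)) :
    proj v (es ++ es') = proj v es ++ proj v es' := List.filterMap_append

theorem proj_cons (v : N) (e : Event N) (es : List (Event N)) :
    proj v (e :: es) = (e.actionOf v).toList ++ proj v es := by
  unfold proj
  rw [List.filterMap_cons]
  cases e.actionOf v <;> rfl

theorem proj_concat (v : N) (es : List (Event N)) (e : Event N) :
    proj v (es ++ [e]) = proj v es ++ (e.actionOf v).toList := by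
  rw [proj_append, proj_cons, proj_nil, List.append_nil]

theorem actionOf_loc_self (v : N) (a : Action N) :
    (Event.loc v a).actionOf v = some a := by simp [Event.actionOf]

theorem actionOf_loc_ne {u v : N} (a : Action N) (h : u ≠ v) :
    (Event.loc v a).actionOf u = none := by simp [Event.actionOf, h]

theorem actionOf_comm_left (v w : N) (x : Var N) (d : Val N) :
    (Event.comm v w x d).actionOf v = some (.send w d) := by simp [Event.actionOf]

theorem actionOf_comm_right {v w : N} (x : Var N) (d : Val N) (h : v ≠ w) :
    (Event.comm v w x d).actionOf w = some (.recv v x d) := by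
  simp [Event.actionOf, h.symm]

theorem actionOf_comm_ne {u v w : N} (x : Var N) (d : Val N) (h : u ≠ v) (h' : u ≠ w) :
    (Event.comm v w x d).actionOf u = none := by simp [Event.actionOf, h, h']

theorem SStep.wf {s t : SState N} {e : Event N} (h : SStep s e t) : e.WF := by
  cases h with
  | loc _ _ _ h => exact h
  | comm _ _ _ _ _ _ h => exact h

theorem SStep.proj {s t : SState N} {e : Event N} (h : SStep s e t) (v : N) :
    Path PStep (s v) (e.actionOf v).toList (t v) := by
  classical
  cases h with
  | loc u a p hl hp =>
    by_cases hu : v = u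
    · subst hu
      rw [actionOf_loc_self, Function.update_self]
      exact .single hp
    · rw [actionOf_loc_ne a hu, Function.update_of_ne hu]
      exact .nil _
  | comm u w x d p q hne hp hq =>
    by_cases hw : v = w
    · subst hw
      rw [actionOf_comm_right x d hne, Function.update_self]
      exact .single hq
    · rw [Function.update_of_ne hw]
      by_cases hu : v = u
      · subst hu
        rw [actionOf_comm_left, Function.update_self]
        exact .single hp
      · rw [actionOf_comm_ne x d hu hw, Function.update_of_ne hu]
        exact .nil _

theorem path_wf {s t : SState N} {es : List (Event N)} (h : Path SStep s es t) :
    ∀ e ∈ es, e.WF := by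
  induction h with
  | nil => simp
  | cons h _ ih =>
    rintro e (_ | ⟨_, he⟩)
    · exact h.wf
    · exact ih e he

theorem path_proj {s t : SState N} {es : List (Event N)} (h : Path SStep s es t) (v : N) :
    Path PStep (s v) (proj v es) (t v) := by
  induction h with
  | nil => exact .nil _
  | cons h _ ih =>
    rw [proj_cons]
    exact (h.proj v).append ih

/-- A list of events is executable as soon as each process can execute its own part of it: the
processes interact only through the actions they perform. -/
theorem path_of_proj {es : List (Event N)} {t : SState N} (hwf : ∀ e ∈ es, e.WF) :
    ∀ s : SState N, (∀ v, Path PStep (s v) (proj v es) (t v)) → Path SStep s es t := by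
  classical
  induction es with
  | nil =>
    intro s h
    have : t = s := funext fun v => Path.nil_iff.1 (h v)
    exact this ▸ .nil _
  | cons e es ih =>
    intro s h
    have ih := ih fun e he => hwf e (List.mem_cons_of_mem _ he)
    have he : e.WF := hwf e List.mem_cons_self
    cases e with
    | loc v a =>
      have hv := h v
      rw [proj_cons, actionOf_loc_self] at hv
      obtain ⟨p, hp, hpt⟩ := Path.cons_iff.1 hv
      refine .cons (SStep.loc s v a p he hp) (ih _ fun u => ?_)
      by_cases hu : u = v
      · subst hu
        rw [Function.update_self]
        exact hpt
      · rw [Function.update_of_ne hu]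
        have := h u
        rwa [proj_cons, actionOf_loc_ne a hu] at this
    | comm v w x d =>
      have hvw : v ≠ w := he
      have hv := h v
      rw [proj_cons, actionOf_comm_left] at hv
      obtain ⟨p, hp, hpt⟩ := Path.cons_iff.1 hv
      have hw := h w
      rw [proj_cons, actionOf_comm_right x d hvw] at hw
      obtain ⟨q, hq, hqt⟩ := Path.cons_iff.1 hw
      refine .cons (SStep.comm s v w x d p q hvw hp hq) (ih _ fun u => ?_)
      by_cases hu : u = w
      · subst hu
        rw [Function.update_self]
        exact hqt
      · rw [Function.update_of_ne hu]
        by_cases hu' : u = v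
        · subst hu'
          rw [Function.update_self]
          exact hpt
        · rw [Function.update_of_ne hu']
          have := h u
          rwa [proj_cons, actionOf_comm_ne x d hu' hu] at this

/-! ### Renaming -/

theorem Val.rename_one (d : Val N) : d.rename 1 = d := by
  induction d <;> simp_all [Val.rename]

theorem Val.rename_mul (σ τ : Equiv.Perm N) (d : Val N) :
    d.rename (σ * τ) = (d.rename τ).rename σ := by
  induction d <;> simp_all [Val.rename]

theorem Var.rename_one (x : Var N) : x.rename 1 = x := by
  cases x; simp [Var.rename]

theorem Var.rename_mul (σ τ : Equiv.Perm N) (x : Var N) :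
    x.rename (σ * τ) = (x.rename τ).rename σ := by
  cases x; simp [Var.rename]

theorem Action.rename_one (a : Action N) : a.rename 1 = a := by
  cases a <;> simp [Action.rename, Val.rename_one, Var.rename_one]

theorem Action.rename_mul (σ τ : Equiv.Perm N) (a : Action N) :
    a.rename (σ * τ) = (a.rename τ).rename σ := by
  cases a <;> simp [Action.rename, Val.rename_mul, Var.rename_mul]

theorem Action.isLocal_rename (σ : Equiv.Perm N) (a : Action N) :
    (a.rename σ).IsLocal ↔ a.IsLocal := by
  cases a <;> simp [Action.rename, Action.IsLocal]

/-- Renaming of the processes in an event. -/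
def Event.rename (σ : Equiv.Perm N) : Event N → Event N
  | .loc v a => .loc (σ v) (a.rename σ)
  | .comm v w x d => .comm (σ v) (σ w) (x.rename σ) (d.rename σ)

theorem Event.WF.rename {e : Event N} (h : e.WF) (σ : Equiv.Perm N) : (e.rename σ).WF := by
  cases e with
  | loc v a => exact (Action.isLocal_rename σ a).2 h
  | comm v w x d => exact fun h' => h (σ.injective h')

theorem actionOf_rename (σ : Equiv.Perm N) (v : N) (e : Event N) :
    (e.rename σ).actionOf (σ v) = (e.actionOf v).map (Action.rename σ) := by
  cases e with
  | loc u a => by_cases h : v = u <;> simp [Event.actionOf, Event.rename, h]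
  | comm u w x d =>
    by_cases h : v = u
    · simp [Event.actionOf, Event.rename, h, Action.rename]
    · by_cases h' : v = w
      · subst h'
        simp [Event.actionOf, Event.rename, h, Action.rename]
      · simp [Event.actionOf, Event.rename, h, h']

theorem proj_rename (σ : Equiv.Perm N) (v : N) (es : List (Event N)) :
    proj (σ v) (es.map (Event.rename σ)) = (proj v es).map (Action.rename σ) := by
  induction es with
  | nil => rfl
  | cons e es ih =>
    rw [List.map_cons, proj_cons, proj_cons, actionOf_rename, ih]
    cases e.actionOf v <;> simp

end CSP

namespace CSP

variable {N : Type*}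

/-! ### Computations and executable lists of events -/

/-- The list of events can be executed from the initial state. -/
def Feasible (P : System N) (es : List (Event N)) : Prop :=
  ∃ s, Path SStep P.init es s

/-- The list of events can be executed from the initial state and leads to proper termination. -/
def Complete (P : System N) (es : List (Event N)) : Prop :=
  ∃ s, Path SStep P.init es s ∧ Finished s

/-- No step is possible. -/
def Stuck (s : SState N) : Prop := ∀ e t, ¬ SStep s e t

/-- All computations are properly terminated. -/
def Terminating (P : System N) : Prop := ∀ C : Computation P, C.ProperlyTerminated

theorem no_step_of_finished {p q : PState N} {a : Action N} (h : p.pos = .run []) :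
    ¬ PStep p a q := by
  intro hs
  cases hs <;> cases h

theorem path_of_finished {p q : PState N} {l : List (Action N)} (h : p.pos = .run [])
    (hl : Path PStep p l q) : l = [] ∧ q = p := by
  cases hl with
  | nil => exact ⟨rfl, rfl⟩
  | cons h' _ => exact absurd h' (no_step_of_finished h)

theorem Finished.stuck {s : SState N} (h : Finished s) : Stuck s := by
  intro e t hs
  cases hs with
  | loc v _ _ _ hp => exact no_step_of_finished (h v) hp
  | comm v _ _ _ _ _ _ hp _ => exact no_step_of_finished (h v) hp

/-- The events of the first `n` steps of a computation. -/
def Computation.events {P : System N} (C : Computation P) : ℕ → List (Event N)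
  | 0 => []
  | n + 1 => C.events n ++ (C.event n).toList

theorem Computation.path {P : System N} (C : Computation P) (n : ℕ) :
    Path SStep P.init (C.events n) (C.state n) := by
  induction n with
  | zero => exact C.start ▸ .nil _
  | succ n ih =>
    rw [events]
    rcases h : C.event n with _ | e
    · rw [(C.ended n h).2]
      simpa using ih
    · exact ih.append (.single (C.next n e h))

theorem Computation.hist_eq {P : System N} (C : Computation P) (v : N) (n : ℕ) :
    C.hist v n = proj v (C.events n) := by
  induction n with
  | zero => rfl
  | succ n ih =>
    rw [hist, events, proj_append, ih]
    rcases C.event n with _ | e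
    · rfl
    · simp [proj_cons]

theorem Computation.of_none {P : System N} (C : Computation P) {n : ℕ} (h : C.event n = none) :
    ∀ m, n ≤ m → C.event m = none ∧ C.state m = C.state n ∧ C.events m = C.events n := by
  intro m hm
  induction m, hm using Nat.le_induction with
  | base => exact ⟨h, rfl, rfl⟩
  | succ m hm ih =>
    obtain ⟨h₁, h₂, h₃⟩ := ih
    have h₄ : C.state (m + 1) = C.state n := by rw [(C.ended m h₁).2, h₂]
    refine ⟨?_, h₄, by rw [events, h₁, h₃]; simp⟩
    rcases h₅ : C.event (m + 1) with _ | e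
    · rfl
    · exact absurd (h₄ ▸ C.next _ e h₅) ((C.ended n h).1 _ _)

theorem Computation.events_prefix {P : System N} (C : Computation P) {m n : ℕ} (h : m ≤ n) :
    C.events m <+: C.events n := by
  induction n, h using Nat.le_induction with
  | base => exact List.prefix_refl _
  | succ n _ ih => exact ih.trans (List.prefix_append _ _)

theorem Computation.events_prefix_of_none {P : System N} (C : Computation P) {n : ℕ}
    (h : C.event n = none) (m : ℕ) : C.events m <+: C.events n := by
  rcases le_total m n with hm | hm
  · exact C.events_prefix hm
  · rw [(C.of_none h m hm).2.2]

theorem Computation.length_events {P : System N} (C : Computation P) {n : ℕ}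
    (h : C.event n = none) (m : ℕ) : (C.events m).length = m ∨ C.events m = C.events n := by
  induction m with
  | zero => exact Or.inl rfl
  | succ m ih =>
    rcases he : C.event m with _ | e
    · right
      rcases le_total m n with hm | hm
      · rw [(C.of_none he n hm).2.2, (C.of_none he (m + 1) (by omega)).2.2]
      · exact (C.of_none h (m + 1) (by omega)).2.2
    · have h₁ : C.events (m + 1) = C.events m ++ [e] := by rw [events, he]; rfl
      rcases ih with ih | ih
      · left
        rw [h₁, List.length_append, ih, List.length_singleton]
      · have h₂ := (C.events_prefix_of_none h (m + 1)).length_le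
        rw [h₁, ih, List.length_append, List.length_singleton] at h₂
        omega

theorem Computation.events_eq_take {P : System N} (C : Computation P) {n : ℕ}
    (h : C.event n = none) (m : ℕ) : C.events m = (C.events n).take m := by
  have hpre := C.events_prefix_of_none h m
  rcases C.length_events h m with hm | hm
  · have := List.prefix_iff_eq_take.1 hpre
    rwa [hm] at this
  · rw [hm]
    by_cases hl : (C.events n).length ≤ m
    · rw [List.take_of_length_le hl]
    · push Not at hl
      -- a computation has performed at most `m` events after `m` steps
      have : (C.events m).length ≤ m := by
        clear hm hl hpre
        induction m with
        | zero => exact Nat.le_refl 0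
        | succ m ih =>
          rw [events, List.length_append]
          have : (C.event m).toList.length ≤ 1 := by cases C.event m <;> simp
          omega
      rw [hm] at this
      omega

/-- An execution as an infinite sequence of states, the last one being repeated. -/
theorem seq_of_path {s t : SState N} {es : List (Event N)} (h : Path SStep s es t) :
    ∃ f : ℕ → SState N, f 0 = s ∧ (∀ n e, es[n]? = some e → SStep (f n) e (f (n + 1))) ∧
      ∀ n, es.length ≤ n → f n = t := by
  induction h with
  | nil s => exact ⟨fun _ => s, rfl, by simp, fun _ _ => rfl⟩
  | @cons s u t a l hs _ ih =>
    obtain ⟨f, h₀, h₁, h₂⟩ := ih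
    refine ⟨fun n => Nat.casesOn n s f, rfl, ?_, ?_⟩
    · rintro (_ | n) e he
      · obtain rfl : a = e := by simpa using he
        simpa [h₀] using hs
      · exact h₁ n e (by simpa using he)
    · rintro (_ | n) hn
      · simp at hn
      · exact h₂ n (by simpa using hn)

/-- A maximal execution is a computation. -/
theorem exists_computation {P : System N} {es : List (Event N)} {t : SState N}
    (h : Path SStep P.init es t) (ht : Stuck t) :
    ∃ C : Computation P, (∀ n, C.event n = es[n]?) ∧ ∀ n, es.length ≤ n → C.state n = t := by
  obtain ⟨f, h₀, h₁, h₂⟩ := seq_of_path h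
  refine ⟨⟨f, fun n => es[n]?, h₀, h₁, fun n hn => ?_⟩, fun _ => rfl, h₂⟩
  rw [List.getElem?_eq_none_iff] at hn
  rw [h₂ n hn, h₂ (n + 1) (by omega)]
  exact ⟨ht, rfl⟩

theorem events_of_event {P : System N} {C : Computation P} {es : List (Event N)}
    (h : ∀ n, C.event n = es[n]?) (n : ℕ) : C.events n = es.take n := by
  induction n with
  | zero => simp [Computation.events]
  | succ n ih => rw [Computation.events, ih, h, List.take_add_one]

/-- `t` is a possible successor of `s`. -/
def Succ (t s : SState N) : Prop := ∃ e, SStep s e t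

/-- There is no infinite execution: it would be a computation without an end. -/
theorem acc_init {P : System N} (hP : Terminating P) : Acc Succ P.init := by
  by_contra hacc
  have key : ∀ s : {s : SState N // ¬ Acc Succ s}, ∃ p : Event N × {s : SState N // ¬ Acc Succ s},
      SStep s.1 p.1 p.2.1 := by
    rintro ⟨s, hs⟩
    obtain ⟨t, ht, e, he⟩ := exists_not_acc_lt_of_not_acc hs
    exact ⟨⟨e, ⟨t, ht⟩⟩, he⟩
  choose f hf using key
  let g : ℕ → {s : SState N // ¬ Acc Succ s} := fun n => (fun s => (f s).2)^[n] ⟨P.init, hacc⟩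
  obtain ⟨n, hn, -⟩ := hP
    { state := fun n => (g n).1
      event := fun n => some (f (g n)).1
      start := rfl
      next := by
        rintro n e ⟨⟩
        have : g (n + 1) = (f (g n)).2 := Function.iterate_succ_apply' _ _ _
        rw [this]
        exact hf _
      ended := by simp }
  simp at hn

theorem acc_of_path {s t : SState N} {es : List (Event N)} (h : Path SStep s es t)
    (hs : Acc Succ s) : Acc Succ t := by
  induction h with
  | nil => exact hs
  | cons h _ ih => exact ih (hs.inv ⟨_, h⟩)

theorem exists_stuck {s : SState N} (hs : Acc Succ s) :
    ∃ es t, Path SStep s es t ∧ Stuck t := by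
  induction hs with
  | intro s _ ih =>
    by_cases h : Stuck s
    · exact ⟨[], s, .nil s, h⟩
    · simp only [Stuck, not_forall, not_not] at h
      obtain ⟨e, t, h⟩ := h
      obtain ⟨es, u, hu, hst⟩ := ih t ⟨e, h⟩
      exact ⟨e :: es, u, .cons h hu, hst⟩

theorem Stuck.finished {P : System N} (hP : Terminating P) {es : List (Event N)} {t : SState N}
    (h : Path SStep P.init es t) (ht : Stuck t) : Finished t := by
  obtain ⟨C, h₁, h₂⟩ := exists_computation h ht
  obtain ⟨n, hn, hf⟩ := hP C
  rw [h₁, List.getElem?_eq_none_iff] at hn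
  rwa [h₂ n hn] at hf

theorem exists_finished {P : System N} (hP : Terminating P) {es : List (Event N)} {s : SState N}
    (h : Path SStep P.init es s) : ∃ es' t, Path SStep s es' t ∧ Finished t := by
  obtain ⟨es', t, ht, hst⟩ := exists_stuck (acc_of_path h (acc_init hP))
  exact ⟨es', t, ht, hst.finished hP (h.append ht)⟩

theorem Complete.feasible {P : System N} {es : List (Event N)} (h : Complete P es) :
    Feasible P es := h.imp fun _ h => h.1

theorem feasible_iff {P : System N} (hP : Terminating P) {es : List (Event N)} :
    Feasible P es ↔ ∃ es', Complete P (es ++ es') := by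
  constructor
  · rintro ⟨s, hs⟩
    obtain ⟨es', t, ht, hf⟩ := exists_finished hP hs
    exact ⟨es', t, hs.append ht, hf⟩
  · rintro ⟨es', t, ht, -⟩
    obtain ⟨s, hs, -⟩ := ht.split
    exact ⟨s, hs⟩

/-! ### Finite branching and the length of executions -/

/-- The possible steps of a process, where `d` is the value delivered by input commands. -/
noncomputable def PState.succs (d : Val N) (p : PState N) : List (Action N × PState N) :=
  match p with
  | ⟨.run [], _⟩ => []
  | ⟨.run (.skip :: k), s⟩ => [(.skip, ⟨.run k, s⟩)]
  | ⟨.run (.assign x e :: k), s⟩ => [(.assign x (e s), ⟨.run k, s.write x (e s)⟩)]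
  | ⟨.run (.send w e :: k), s⟩ => [(.send w (e s), ⟨.run k, s⟩)]
  | ⟨.run (.recv w x :: k), s⟩ => [(.recv w x d, ⟨.run k, s.write x d⟩)]
  | ⟨.run (.sel bs :: k), s⟩ => [(.guards, ⟨.await (notClosed s bs) k, s⟩)]
  | ⟨.run (.rep bs :: k), s⟩ =>
      [(.guards, ⟨.await (notClosed s bs) (.rep bs :: k), s⟩), (.exit, ⟨.run k, s⟩)]
  | ⟨.await bs k, s⟩ => bs.map fun b =>
      match b.1.comm with
      | .none => (.choose, ⟨.run (b.2 ++ k), s⟩)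
      | .input w x => (.recv w x d, ⟨.run (b.2 ++ k), s.write x d⟩)
      | .output w e => (.send w (e s), ⟨.run (b.2 ++ k), s⟩)

theorem PStep.mem_succs {p q : PState N} {a : Action N} (h : PStep p a q) (d : Val N)
    (ha : ∀ w x d', a = .recv w x d' → d' = d) : (a, q) ∈ p.succs d := by
  cases h with
  | skip => simp [PState.succs]
  | assign => simp [PState.succs]
  | send => simp [PState.succs]
  | recv w x d' =>
    obtain rfl := ha _ _ _ rfl
    simp [PState.succs]
  | sel => simp [PState.succs]
  | rep => simp [PState.succs]
  | exit => simp [PState.succs]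
  | choose bs k s b hb hc =>
    exact List.mem_map.2 ⟨b, hb, by simp [hc]⟩
  | guard_recv bs k s b w x d' hb hc =>
    obtain rfl := ha _ _ _ rfl
    exact List.mem_map.2 ⟨b, hb, by simp [hc]⟩
  | guard_send bs k s b w e hb hc =>
    exact List.mem_map.2 ⟨b, hb, by simp [hc]⟩

theorem finite_succ [Finite N] (s : SState N) : {t | Succ t s}.Finite := by
  classical
  let F : Val N → N → Set (Action N × PState N) := fun d v => {p | p ∈ (s v).succs d}
  have hF : ∀ d v, (F d v).Finite := fun d v => List.finite_toSet _
  refine Set.Finite.subset (s := (⋃ v, (fun p => Function.update s v p.2) '' F .unset v) ∪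
    ⋃ v, ⋃ w, ⋃ p ∈ F .unset v, ⋃ d ∈ {d | p.1 = .send w d},
      (fun q => Function.update (Function.update s v p.2) w q.2) '' F d w) ?_ ?_
  · refine (Set.finite_iUnion fun v => (hF _ v).image _).union (Set.finite_iUnion fun v =>
      Set.finite_iUnion fun w => (hF _ v).biUnion fun p _ => Set.Finite.biUnion ?_ fun d _ =>
        (hF d w).image _)
    refine Set.Subsingleton.finite fun d hd d' hd' => ?_
    have : Action.send w d = .send w d' := hd.symm.trans hd'
    simpa using this
  · rintro t ⟨e, he⟩
    cases he with
    | loc v a p hl hp =>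
      refine Or.inl (Set.mem_iUnion.2 ⟨v, (a, p), hp.mem_succs _ ?_, rfl⟩)
      rintro w x d rfl
      exact hl.elim
    | comm v w x d p q hne hp hq =>
      refine Or.inr ?_
      simp only [Set.mem_iUnion]
      refine ⟨v, w, (_, p), hp.mem_succs _ (by simp), d, rfl, (_, q), hq.mem_succs d ?_, rfl⟩
      rintro _ _ _ ⟨⟩
      rfl

/-- Since branching is finite, termination of all executions bounds their length. -/
theorem exists_length_bound [Finite N] {s : SState N} (hs : Acc Succ s) :
    ∃ B, ∀ es t, Path SStep s es t → es.length ≤ B := by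
  induction hs with
  | intro s _ ih =>
    choose! B hB using ih
    obtain ⟨M, hM⟩ := ((finite_succ s).image B).bddAbove
    refine ⟨M + 1, fun es t h => ?_⟩
    cases h with
    | nil => simp
    | @cons _ u _ e l h₁ h₂ =>
      have h₃ := hB u ⟨e, h₁⟩ l t h₂
      have h₄ := hM ⟨u, ⟨e, h₁⟩, rfl⟩
      simp only [List.length_cons]
      omega

/-! ### Symmetry in terms of complete executions -/

/-- A symmetry maps complete executions to complete executions: the computation with the same
steps that symmetry provides can be reordered to follow the given order of events. -/
theorem complete_rename {P : System N} (hP : Terminating P) {V : Set N} {G' : Digraph N}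
    {S : V → Set N} (hsym : P.IsGSymmetric V G' S) {σ : Equiv.Perm N} (h₁ : Network.IsAut G' σ)
    (h₂ : Network.Respects V S σ) {es : List (Event N)} (h : Complete P es) :
    Complete P (es.map (Event.rename σ)) := by
  obtain ⟨t, ht, hf⟩ := h
  obtain ⟨C, hC, -⟩ := exists_computation ht hf.stuck
  obtain ⟨C', hC'⟩ := hsym σ h₁ h₂ C
  obtain ⟨n, hn, hfin⟩ := hP C'
  have hes : C.events es.length = es := by rw [events_of_event hC, List.take_length]
  have hCnone : C.event es.length = none := by rw [hC, List.getElem?_eq_none_iff]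
  have key : ∀ v, proj (σ v) (C'.events n) = (proj v es).map (Action.rename σ) := by
    intro v
    have hpre : ∀ {m : ℕ}, C'.hist (σ v) m <+: proj (σ v) (C'.events n) := fun {m} => by
      rw [C'.hist_eq]
      exact (C'.events_prefix_of_none hn m).filterMap _
    have hpre' : ∀ {m : ℕ}, C.hist v m <+: proj v es := fun {m} => by
      rw [C.hist_eq]
      conv_rhs => rw [← hes]
      exact (C.events_prefix_of_none hCnone m).filterMap _
    obtain ⟨_, ⟨m, rfl⟩, hm⟩ := (hC' v).subset ⟨n, rfl⟩
    obtain ⟨m', hm'⟩ := (hC' v).superset ⟨_, ⟨es.length, rfl⟩, rfl⟩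
    rw [C'.hist_eq] at hm
    rw [C.hist_eq, hes] at hm'
    have a₁ : proj (σ v) (C'.events n) <+: (proj v es).map (Action.rename σ) :=
      hm ▸ hpre'.map _
    have a₂ : (proj v es).map (Action.rename σ) <+: proj (σ v) (C'.events n) :=
      hm' ▸ hpre
    exact a₁.eq_of_length (le_antisymm a₁.length_le a₂.length_le)
  refine ⟨C'.state n, path_of_proj ?_ _ fun u => ?_, hfin⟩
  · simp only [List.mem_map]
    rintro _ ⟨e, he, rfl⟩
    exact (path_wf ht e he).rename σ
  · obtain ⟨v, rfl⟩ := σ.surjective u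
    rw [proj_rename, ← key]
    exact path_proj (C'.path n) _

/-- The converse of `complete_rename`: to repeat the steps of a terminating computation it suffices
to execute the renamed list of its events. -/
theorem isGSymmetric_of_complete_rename {P : System N} (hP : Terminating P) {V : Set N}
    {G' : Digraph N} {S : V → Set N}
    (h : ∀ σ : Equiv.Perm N, Network.IsAut G' σ → Network.Respects V S σ →
      ∀ es, Complete P es → Complete P (es.map (Event.rename σ))) :
    P.IsGSymmetric V G' S := by
  intro σ h₁ h₂ C
  obtain ⟨n, hn, hf⟩ := hP C
  obtain ⟨t, ht, hft⟩ := h σ h₁ h₂ _ ⟨_, C.path n, hf⟩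
  obtain ⟨C', hC', -⟩ := exists_computation ht hft.stuck
  refine ⟨C', fun v => ?_⟩
  have htake : ∀ m, C.events m = (C.events n).take m := fun m => C.events_eq_take hn m
  have key : ∀ m, C'.hist (σ v) m = (C.hist v m).map (Action.rename σ) := by
    intro m
    rw [C'.hist_eq, C.hist_eq, events_of_event hC', ← proj_rename, htake m, List.map_take]
  ext l
  simp [key]

end CSP

namespace CSP

variable {N : Type*}

/-! ### Communication commands of a process and the text of its program -/

theorem Occurs.trans {t u : Stmt N} {p : Prog N} {bs : List (Guard N × Prog N)}
    {b : Guard N × Prog N} (hu : u = .sel bs ∨ u = .rep bs) (h : Occurs u p) (hb : b ∈ bs)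
    (ht : Occurs t b.2) : Occurs t p := by
  induction h with
  | here h =>
    rcases hu with rfl | rfl
    · exact .in_sel h hb ht
    · exact .in_rep h hb ht
  | in_sel h₁ h₂ _ ih => exact .in_sel h₁ h₂ ih
  | in_rep h₁ h₂ _ ih => exact .in_rep h₁ h₂ ih

/-- What is still to be executed by a process is part of the text of its program `p`. -/
def Within (p : Prog N) : Pos N → Prop
  | .run k => ∀ t ∈ k, Occurs t p
  | .await bs k => (∀ t ∈ k, Occurs t p) ∧
      ∃ bs₀, (Occurs (.sel bs₀) p ∨ Occurs (.rep bs₀) p) ∧ ∀ b ∈ bs, b ∈ bs₀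

theorem Within.branch {p : Prog N} {bs : List (Guard N × Prog N)} {k : Prog N}
    (h : Within p (.await bs k)) {b : Guard N × Prog N} (hb : b ∈ bs) :
    Within p (.run (b.2 ++ k)) := by
  obtain ⟨hk, bs₀, h₀, hbs⟩ := h
  intro t ht
  rcases List.mem_append.1 ht with ht | ht
  · rcases h₀ with h₀ | h₀
    · exact h₀.trans (Or.inl rfl) (hbs b hb) (.here ht)
    · exact h₀.trans (Or.inr rfl) (hbs b hb) (.here ht)
  · exact hk t ht

theorem Within.guard {p : Prog N} {bs : List (Guard N × Prog N)} {k : Prog N}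
    (h : Within p (.await bs k)) {b : Guard N × Prog N} (hb : b ∈ bs) : GuardOccurs b.1 p := by
  obtain ⟨-, bs₀, h₀, hbs⟩ := h
  exact ⟨bs₀, b.2, hbs b hb, h₀⟩

theorem Within.tail {p k : Prog N} {t : Stmt N} (h : Within p (.run (t :: k))) :
    Within p (.run k) := fun u hu => h u (List.mem_cons_of_mem _ hu)

theorem Within.head {p k : Prog N} {t : Stmt N} (h : Within p (.run (t :: k))) :
    Occurs t p := h t List.mem_cons_self

theorem Within.step {prog : Prog N} {p q : PState N} {a : Action N} (h : Within prog p.pos)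
    (hs : PStep p a q) : Within prog q.pos := by
  cases hs with
  | skip | assign | send | recv | exit => exact h.tail
  | sel bs k s => exact ⟨h.tail, bs, Or.inl h.head, fun b hb => (List.mem_filter.1 hb).1⟩
  | rep bs k s => exact ⟨h, bs, Or.inr h.head, fun b hb => (List.mem_filter.1 hb).1⟩
  | choose bs k s b hb => exact h.branch hb
  | guard_recv bs k s b w x d hb => exact h.branch hb
  | guard_send bs k s b w e hb => exact h.branch hb

theorem within_of_path {prog : Prog N} {p q : PState N} {l : List (Action N)}
    (hl : Path PStep p l q) (h : Within prog p.pos) : Within prog q.pos := by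
  induction hl with
  | nil => exact h
  | cons hs _ ih => exact ih (h.step hs)

theorem within_init {P : System N} {v : N} {l : List (Action N)} {p : PState N}
    (h : Path PStep (P.init v) l p) : Within (P v) p.pos :=
  within_of_path h fun _ ht => .here ht

theorem adj_of_send {P : System N} {G' : Digraph N} (hP : P.AdmittedBy G') {v w : N}
    {l : List (Action N)} {p q : PState N} {d : Val N} (h : Path PStep (P.init v) l p)
    (hs : PStep p (.send w d) q) : G'.Adj v w := by
  have hw := within_init h
  refine hP v w (Or.inl ?_)
  cases hs with
  | send _ e => exact Or.inl ⟨e, hw.head⟩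
  | guard_send _ _ _ b _ e hb hc => exact Or.inr ⟨b.1, e, hw.guard hb, hc⟩

theorem adj_of_recv {P : System N} {G' : Digraph N} (hP : P.AdmittedBy G') {v w : N}
    {l : List (Action N)} {p q : PState N} {x : Var N} {d : Val N}
    (h : Path PStep (P.init v) l p) (hs : PStep p (.recv w x d) q) : G'.Adj w v := by
  have hw := within_init h
  refine hP w v (Or.inr ?_)
  cases hs with
  | recv _ x => exact Or.inl ⟨x, hw.head⟩
  | guard_recv _ _ _ b _ x _ hb hc => exact Or.inr ⟨b.1, x, hw.guard hb, hc⟩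

/-- Without output guards, a process that can send is committed to that output. -/
theorem eq_of_send {P : System N} (hP : P.InCSPin) {v w : N} {l : List (Action N)}
    {p q q' : PState N} {d : Val N} {a : Action N} (h : Path PStep (P.init v) l p)
    (hs : PStep p (.send w d) q) (ha : PStep p a q') : a = .send w d := by
  have hw := within_init h
  cases hs with
  | send => cases ha; rfl
  | guard_send _ _ _ b _ e hb hc => exact absurd hc (hP v b.1 (hw.guard hb) w e)

/-- The program of the receiver does not restrict the value received. -/
theorem PStep.recv_any {p q : PState N} {w : N} {x : Var N} {d : Val N}
    (h : PStep p (.recv w x d) q) (d' : Val N) : ∃ q', PStep p (.recv w x d') q' := by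
  cases h with
  | recv => exact ⟨_, .recv ..⟩
  | guard_recv bs k s b _ _ _ hb hc => exact ⟨_, .guard_recv bs k s b w x d' hb hc⟩

end CSP

namespace CSP

/-! ### Machines and their implementation in CSP with input guards -/

/-- What a process of a machine does next: a step of its own, an output it is committed to, waiting
for a message from one of the processes in `L`, or stopping with the leader `l`. -/
inductive Move (N : Type*)
  | inner : Move N
  | send (w : N) (m : Val N) : Move N
  | listen (L : Set N) : Move N
  | halt (l : N) : Move N

/-- Renaming of the processes in a move. -/
def Move.rename {N : Type*} (σ : Equiv.Perm N) : Move N → Move N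
  | .inner => .inner
  | .send w m => .send (σ w) (m.rename σ)
  | .listen L => .listen (σ '' L)
  | .halt l => .halt (σ l)

/-- The value to be sent. -/
def Move.payload {N : Type*} : Move N → Val N
  | .send _ m => m
  | _ => .unset

/-- The name announced by a halting process. -/
def Move.result {N : Type*} : Move N → Val N
  | .halt l => .name l
  | _ => .unset

/-- A family of communicating automata with the set of states `Q`. The effects of inner steps and of
inputs are relations: the specification of an admissible new state. -/
structure Machine (N Q : Type*) where
  init : N → Q
  move : N → Q → Move N
  /-- `innerR v q q'`: an inner step may lead `v` from the state `q` to the state `q'`. -/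
  innerR : N → Q → Q → Prop
  /-- `recvR v q w m q'`: on receiving `m` from `w` in the state `q` the process `v` may go to
  the state `q'`. -/
  recvR : N → Q → N → Val N → Q → Prop
  /-- the state after an output -/
  sent : N → Q → Q

namespace Machine

variable {N Q : Type*}

/-- The machine is invariant under the group `A` of permutations of names. -/
structure IsSymm [MulAction (Equiv.Perm N) Q] (M : Machine N Q)
    (A : Subgroup (Equiv.Perm N)) : Prop where
  init : ∀ σ ∈ A, ∀ v, M.init (σ v) = σ • M.init v
  move : ∀ σ ∈ A, ∀ v q, M.move (σ v) (σ • q) = (M.move v q).rename σ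
  innerR : ∀ σ ∈ A, ∀ v q q', M.innerR v q q' → M.innerR (σ v) (σ • q) (σ • q')
  recvR : ∀ σ ∈ A, ∀ v q w m q', M.recvR v q w m q' →
    M.recvR (σ v) (σ • q) (σ w) (m.rename σ) (σ • q')
  sent : ∀ σ ∈ A, ∀ v q, M.sent (σ v) (σ • q) = σ • M.sent v q

/-- The machine communicates along the edges of `G'`, and a listening process listens to someone. -/
structure Fits (M : Machine N Q) (G' : Digraph N) : Prop where
  send : ∀ v q w m, M.move v q = .send w m → G'.Adj v w
  listen : ∀ v q L, M.move v q = .listen L → L.Nonempty ∧ ∀ w ∈ L, G'.Adj w v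

section choice

variable [MulAction (Equiv.Perm N) Q] (M : Machine N Q) {A : Subgroup (Equiv.Perm N)}

open Classical in
/-- An arbitrary admissible result of an inner step, if there is one. -/
noncomputable def someInner (v : N) (q : Q) : Q :=
  if h : ∃ q', M.innerR v q q' then h.choose else q

open Classical in
/-- An arbitrary admissible result of an input, if there is one. -/
noncomputable def someRecv (v : N) (q : Q) (w : N) (m : Val N) : Q :=
  if h : ∃ q', M.recvR v q w m q' then h.choose else q

/-- The arbitrary choice of `someInner`, conjugated by `τ`. No single choice need be symmetric, but
the family of all its conjugates is. -/
noncomputable def pickInner (τ : Equiv.Perm N) (v : N) (q : Q) : Q :=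
  τ • M.someInner (τ⁻¹ v) (τ⁻¹ • q)

/-- The arbitrary choice of `someRecv`, conjugated by `τ`. -/
noncomputable def pickRecv (τ : Equiv.Perm N) (v : N) (q : Q) (w : N) (m : Val N) : Q :=
  τ • M.someRecv (τ⁻¹ v) (τ⁻¹ • q) (τ⁻¹ w) (m.rename τ⁻¹)

theorem pickInner_mul (σ τ : Equiv.Perm N) (v : N) (q : Q) :
    M.pickInner (σ * τ) (σ v) (σ • q) = σ • M.pickInner τ v q := by
  simp [pickInner, mul_smul]

theorem pickRecv_mul (σ τ : Equiv.Perm N) (v : N) (q : Q) (w : N) (m : Val N) :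
    M.pickRecv (σ * τ) (σ v) (σ • q) (σ w) (m.rename σ) = σ • M.pickRecv τ v q w m := by
  have : (m.rename σ).rename (τ⁻¹ * σ⁻¹) = m.rename τ⁻¹ := by
    rw [← Val.rename_mul, inv_mul_cancel_right]
  simp [pickRecv, mul_smul, this]

variable {M}

/-- The conjugated choices are admissible whenever an admissible state exists. -/
theorem IsSymm.pickInner (hM : M.IsSymm A) {τ : Equiv.Perm N} (hτ : τ ∈ A) {v : N} {q : Q}
    (h : ∃ q', M.innerR v q q') : M.innerR v q (M.pickInner τ v q) := by
  obtain ⟨q', hq'⟩ := h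
  have h₁ : ∃ q', M.innerR (τ⁻¹ v) (τ⁻¹ • q) q' := ⟨_, hM.innerR _ (inv_mem hτ) _ _ _ hq'⟩
  have h₂ := hM.innerR τ hτ _ _ _ h₁.choose_spec
  rw [smul_inv_smul, (by simp : τ (τ⁻¹ v) = v)] at h₂
  rw [Machine.pickInner, someInner, dif_pos h₁]
  exact h₂

theorem IsSymm.pickRecv (hM : M.IsSymm A) {τ : Equiv.Perm N} (hτ : τ ∈ A) {v : N} {q : Q}
    {w : N} {m : Val N} (h : ∃ q', M.recvR v q w m q') :
    M.recvR v q w m (M.pickRecv τ v q w m) := by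
  obtain ⟨q', hq'⟩ := h
  have h₁ : ∃ q', M.recvR (τ⁻¹ v) (τ⁻¹ • q) (τ⁻¹ w) (m.rename τ⁻¹) q' :=
    ⟨_, hM.recvR _ (inv_mem hτ) _ _ _ _ _ hq'⟩
  have h₂ := hM.recvR τ hτ _ _ _ _ _ h₁.choose_spec
  rw [smul_inv_smul, (by simp : τ (τ⁻¹ v) = v), (by simp : τ (τ⁻¹ w) = w), ← Val.rename_mul,
    mul_inv_cancel, Val.rename_one] at h₂
  rw [Machine.pickRecv, someRecv, dif_pos h₁]
  exact h₂

end choice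

/-- The variable holding the encoded state of the machine. -/
def stateVar : Var N := ⟨1, []⟩

/-- The variable receiving messages. -/
def inboxVar : Var N := ⟨2, []⟩

section program

variable [Nonempty Q] [MulAction (Equiv.Perm N) Q] (M : Machine N Q) (enc : Q → Val N)
  (A : Subgroup (Equiv.Perm N)) (G' : Digraph N)

/-- The state of the machine held by a store. -/
noncomputable def read (s : Store N) : Q := Function.invFun enc (s stateVar)

open Classical in
/-- The branch for inner steps with the choice conjugated by `τ`; it is closed unless `τ ∈ A`. -/
noncomputable def innerBranch (v : N) (τ : Equiv.Perm N) : Guard N × Prog N :=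
  (⟨fun s => decide (τ ∈ A ∧ M.move v (read enc s) = .inner), .none⟩,
    [.assign stateVar fun s => enc (M.pickInner τ v (read enc s))])

open Classical in
/-- The branch for outputs to `w`; the output itself is not in the guard. -/
noncomputable def sendBranch (v w : N) : Guard N × Prog N :=
  (⟨fun s => decide (∃ m, M.move v (read enc s) = .send w m), .none⟩,
    [.send w fun s => Move.payload (M.move v (read enc s)),
      .assign stateVar fun s => enc (M.sent v (read enc s))])

open Classical in
/-- The branch for inputs from `w`, with the choice of the new state conjugated by `τ`. -/
noncomputable def recvBranch (v w : N) (τ : Equiv.Perm N) : Guard N × Prog N :=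
  (⟨fun s => decide (τ ∈ A ∧ ∃ L, M.move v (read enc s) = .listen L ∧ w ∈ L),
      .input w inboxVar⟩,
    [.assign stateVar fun s => enc (M.pickRecv τ v (read enc s) w (s inboxVar))])

/-- The branches of the main loop of process `v`, as a set: distinct `τ` may give the same
branch. -/
def branchSet (v : N) : Set (Guard N × Prog N) :=
  Set.range (M.innerBranch enc A v) ∪ M.sendBranch enc v '' {w | G'.Adj v w} ∪
    (fun p : N × Equiv.Perm N => M.recvBranch enc A v p.1 p.2) '' {p | G'.Adj p.1 v}

variable [Finite N]

theorem finite_branchSet (v : N) : (M.branchSet enc A G' v).Finite :=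
  ((Set.finite_range _).union ((Set.toFinite _).image _)).union ((Set.toFinite _).image _)

/-- The branches of the main loop of process `v`, in arbitrary order. -/
noncomputable def branches (v : N) : List (Guard N × Prog N) :=
  (M.finite_branchSet enc A G' v).toFinset.toList

theorem mem_branches {v : N} {b : Guard N × Prog N} :
    b ∈ M.branches enc A G' v ↔ (∃ τ, b = M.innerBranch enc A v τ) ∨
      (∃ w, G'.Adj v w ∧ b = M.sendBranch enc v w) ∨
      ∃ w τ, G'.Adj w v ∧ b = M.recvBranch enc A v w τ := by
  rw [branches, Finset.mem_toList, Set.Finite.mem_toFinset, branchSet, Set.mem_union,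
    Set.mem_union, or_assoc]
  refine or_congr ?_ (or_congr ?_ ?_)
  · simp only [Set.mem_range, eq_comm]
  · simp only [Set.mem_image, Set.mem_ofPred_eq, eq_comm]
  · simp only [Set.mem_image, Set.mem_ofPred_eq, Prod.exists, eq_comm]

/-- The main loop of process `v`, followed by the announcement of the result. -/
noncomputable def loop (v : N) : Prog N :=
  [.rep (M.branches enc A G' v),
    .assign leader fun s => Move.result (M.move v (read enc s))]

/-- The CSP program of process `v`: an interpreter of the machine. -/
noncomputable def toSystem : System N := fun v =>
  .assign stateVar (fun _ => enc (M.init v)) :: M.loop enc A G' v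

/-- Statements of the program are not nested deeper than in the branches of the main loop. -/
theorem mem_or_mem_branch_of_occurs {v : N} {t : Stmt N} (h : Occurs t (M.toSystem enc A G' v)) :
    t ∈ M.toSystem enc A G' v ∨ ∃ b ∈ M.branches enc A G' v, t ∈ b.2 := by
  have hbody : ∀ b ∈ M.branches enc A G' v, ∀ bs, Stmt.sel bs ∉ b.2 ∧ Stmt.rep bs ∉ b.2 := by
    intro b hb bs
    rcases (M.mem_branches enc A G').1 hb with ⟨τ, rfl⟩ | ⟨w, -, rfl⟩ | ⟨w, τ, -, rfl⟩ <;>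
      simp [innerBranch, sendBranch, recvBranch]
  have hin : ∀ b ∈ M.branches enc A G' v, Occurs t b.2 → t ∈ b.2 := by
    intro b hb ht
    cases ht with
    | here h => exact h
    | in_sel h => exact absurd h (hbody b hb _).1
    | in_rep h => exact absurd h (hbody b hb _).2
  cases h with
  | here h => exact Or.inl h
  | in_sel h => simp [toSystem, loop] at h
  | @in_rep _ bs b h hb ht =>
    obtain rfl : bs = M.branches enc A G' v := by simpa [toSystem, loop] using h
    exact Or.inr ⟨b, hb, hin b hb ht⟩

theorem mem_branches_of_guardOccurs {v : N} {g : Guard N}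
    (h : GuardOccurs g (M.toSystem enc A G' v)) : ∃ b ∈ M.branches enc A G' v, g = b.1 := by
  obtain ⟨bs, c, hg, h⟩ := h
  suffices bs = M.branches enc A G' v from ⟨_, this ▸ hg, rfl⟩
  rcases h with h | h
  all_goals
    rcases M.mem_or_mem_branch_of_occurs enc A G' h with h | ⟨b, hb, h⟩
    · simp [toSystem, loop] at h
      try exact h
    · rcases (M.mem_branches enc A G').1 hb with ⟨τ, rfl⟩ | ⟨w, -, rfl⟩ | ⟨w, τ, -, rfl⟩ <;>
        simp [innerBranch, sendBranch, recvBranch] at h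

theorem toSystem_inCSPin : (M.toSystem enc A G').InCSPin := by
  intro v g hg w e he
  obtain ⟨b, hb, rfl⟩ := M.mem_branches_of_guardOccurs enc A G' hg
  rcases (M.mem_branches enc A G').1 hb with ⟨τ, rfl⟩ | ⟨w, -, rfl⟩ | ⟨w, τ, -, rfl⟩ <;> cases he

theorem toSystem_admittedBy : (M.toSystem enc A G').AdmittedBy G' := by
  rintro v w ((⟨e, h⟩ | ⟨g, e, hg, he⟩) | (⟨x, h⟩ | ⟨g, x, hg, hx⟩))
  · rcases M.mem_or_mem_branch_of_occurs enc A G' h with h | ⟨b, hb, h⟩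
    · simp [toSystem, loop] at h
    · rcases (M.mem_branches enc A G').1 hb with ⟨τ, rfl⟩ | ⟨w, hw, rfl⟩ | ⟨w, τ, -, rfl⟩
      · simp [innerBranch] at h
      · obtain ⟨rfl, -⟩ := by simpa [sendBranch] using h
        exact hw
      · simp [recvBranch] at h
  · exact absurd he (M.toSystem_inCSPin enc A G' v g hg w e)
  · rcases M.mem_or_mem_branch_of_occurs enc A G' h with h | ⟨b, hb, h⟩
    · simp [toSystem, loop] at h
    · rcases (M.mem_branches enc A G').1 hb with ⟨τ, rfl⟩ | ⟨w, -, rfl⟩ | ⟨w, τ, -, rfl⟩ <;>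
        simp [innerBranch, sendBranch, recvBranch] at h
  · obtain ⟨b, hb, rfl⟩ := M.mem_branches_of_guardOccurs enc A G' hg
    rcases (M.mem_branches enc A G').1 hb with ⟨τ, rfl⟩ | ⟨w, -, rfl⟩ | ⟨w, τ, hw, rfl⟩
    · cases hx
    · cases hx
    · cases hx
      exact hw

end program

end Machine

end CSP

namespace CSP

theorem Store.write_self {N : Type*} (s : Store N) (x : Var N) (d : Val N) : s.write x d x = d := by
  simp [Store.write]

theorem Store.write_of_ne {N : Type*} (s : Store N) {x y : Var N} (d : Val N) (h : y ≠ x) :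
    s.write x d y = s y := by
  simp [Store.write, h]

namespace Machine

/-! ### Correctness of the implementation -/

/-- The control points of the program of a process, with the current state of the machine, which is
fixed before it is written to `stateVar`. -/
inductive Code (N Q : Type*)
  | start : Code N Q
  /-- at the head of the main loop -/
  | head (q : Q) : Code N Q
  /-- in the main loop, with the Boolean guards evaluated -/
  | await (q : Q) : Code N Q
  /-- at the output to `w` -/
  | output (q : Q) (w : N) : Code N Q
  /-- about to store the new state `q` -/
  | update (q : Q) : Code N Q
  /-- about to announce the result -/
  | last (q : Q) : Code N Q
  | done (q : Q) : Code N Q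

variable {N Q : Type*}

theorem read_eq [Nonempty Q] {enc : Q → Val N} (henc : Function.Injective enc) {s : Store N} {q : Q}
    (h : s stateVar = enc q) : read enc s = q := by
  rw [read, h]
  exact Function.leftInverse_invFun henc q

theorem stateVar_ne_inboxVar : (stateVar : Var N) ≠ inboxVar := by
  simp [stateVar, inboxVar]

section

variable [MulAction (Equiv.Perm N) Q] (M : Machine N Q) (enc : Q → Val N)
  (A : Subgroup (Equiv.Perm N))

/-- The steps of the program of `v` in terms of control points. -/
inductive CStep (v : N) : Code N Q → Action N → Code N Q → Prop
  | start : CStep v .start (.assign stateVar (enc (M.init v))) (.head (M.init v))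
  | guards (q : Q) : (∀ l, M.move v q ≠ .halt l) → CStep v (.head q) .guards (.await q)
  | exit (q : Q) (l : N) : M.move v q = .halt l → CStep v (.head q) .exit (.last q)
  | inner (q : Q) (τ : Equiv.Perm N) : M.move v q = .inner → τ ∈ A →
      CStep v (.await q) .choose (.update (M.pickInner τ v q))
  | choose (q : Q) (w : N) (m : Val N) : M.move v q = .send w m →
      CStep v (.await q) .choose (.output q w)
  | send (q : Q) (w : N) (m : Val N) : M.move v q = .send w m →
      CStep v (.output q w) (.send w m) (.update (M.sent v q))
  | recv (q : Q) (L : Set N) (w : N) (d : Val N) (τ : Equiv.Perm N) :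
      M.move v q = .listen L → w ∈ L → τ ∈ A →
      CStep v (.await q) (.recv w inboxVar d) (.update (M.pickRecv τ v q w d))
  | update (q : Q) : CStep v (.update q) (.assign stateVar (enc q)) (.head q)
  | last (q : Q) (l : N) : M.move v q = .halt l →
      CStep v (.last q) (.assign leader (.name l)) (.done q)

variable {M enc A}

/-- Renaming of control points. -/
def Code.rename (σ : Equiv.Perm N) : Code N Q → Code N Q
  | .start => .start
  | .head q => .head (σ • q)
  | .await q => .await (σ • q)
  | .output q w => .output (σ • q) (σ w)
  | .update q => .update (σ • q)
  | .last q => .last (σ • q)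
  | .done q => .done (σ • q)

/-- A step that uses the choice conjugated by `τ` becomes a step that uses the choice conjugated by
`σ * τ`. -/
theorem CStep.rename (hM : M.IsSymm A)
    (hsmul : ∀ (σ : Equiv.Perm N) (q : Q), enc (σ • q) = (enc q).rename σ) {σ : Equiv.Perm N}
    (hσ : σ ∈ A) {v : N} {c c' : Code N Q} {a : Action N} (h : M.CStep enc A v c a c') :
    M.CStep enc A (σ v) (c.rename σ) (a.rename σ) (c'.rename σ) := by
  have hst : (stateVar : Var N).rename σ = stateVar := rfl
  have hin : (inboxVar : Var N).rename σ = inboxVar := rfl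
  have hmv := hM.move σ hσ v
  have hne : ∀ q, (∀ l, M.move v q ≠ .halt l) → ∀ l, M.move (σ v) (σ • q) ≠ .halt l := by
    intro q h l hl
    rw [hmv] at hl
    rcases hm : M.move v q with _ | ⟨w, m⟩ | L | l'
    · simp [hm, Move.rename] at hl
    · simp [hm, Move.rename] at hl
    · simp [hm, Move.rename] at hl
    · exact h l' hm
  cases h with
  | start =>
    simp only [Code.rename, Action.rename, hst, ← hsmul, ← hM.init σ hσ]
    exact .start
  | guards q h => exact .guards _ (hne q h)
  | exit q l h => exact .exit _ (σ l) (by rw [hmv, h]; rfl)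
  | inner q τ h hτ =>
    simp only [Code.rename, Action.rename, ← pickInner_mul]
    exact .inner _ _ (by rw [hmv, h]; rfl) (mul_mem hσ hτ)
  | choose q w m h => exact .choose _ _ (m.rename σ) (by rw [hmv, h]; rfl)
  | send q w m h =>
    simp only [Code.rename, Action.rename, ← hM.sent σ hσ]
    exact .send _ _ _ (by rw [hmv, h]; rfl)
  | recv q L w d τ h hw hτ =>
    simp only [Code.rename, Action.rename, hin, ← pickRecv_mul]
    exact .recv _ (σ '' L) _ _ _ (by rw [hmv, h]; rfl) ⟨w, hw, rfl⟩ (mul_mem hσ hτ)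
  | update q =>
    simp only [Code.rename, Action.rename, hst]
    rw [← hsmul]
    exact .update _
  | last q l h => exact .last _ (σ l) (by rw [hmv, h]; rfl)

theorem path_rename (hM : M.IsSymm A)
    (hsmul : ∀ (σ : Equiv.Perm N) (q : Q), enc (σ • q) = (enc q).rename σ) {σ : Equiv.Perm N}
    (hσ : σ ∈ A) {v : N} {c c' : Code N Q} {l : List (Action N)}
    (h : Path (M.CStep enc A v) c l c') :
    Path (M.CStep enc A (σ v)) (c.rename σ) (l.map (Action.rename σ)) (c'.rename σ) := by
  induction h with
  | nil => exact .nil _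
  | cons h _ ih => exact .cons (h.rename hM hsmul hσ) ih

end

variable [Nonempty Q] [MulAction (Equiv.Perm N) Q] [Finite N]
  (M : Machine N Q) (enc : Q → Val N) (A : Subgroup (Equiv.Perm N)) (G' : Digraph N)

/-- The process state of `v` is at the given control point. -/
def At (v : N) : PState N → Code N Q → Prop
  | p, .start => p = ⟨.run (M.toSystem enc A G' v), fun _ => .unset⟩
  | ⟨pos, s⟩, .head q => s stateVar = enc q ∧ pos = .run (M.loop enc A G' v)
  | ⟨pos, s⟩, .await q => s stateVar = enc q ∧ (∀ l, M.move v q ≠ .halt l) ∧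
      pos = .await (notClosed s (M.branches enc A G' v)) (M.loop enc A G' v)
  | ⟨pos, s⟩, .output q w => s stateVar = enc q ∧ (∃ m, M.move v q = .send w m) ∧
      pos = .run ((M.sendBranch enc v w).2 ++ M.loop enc A G' v)
  | ⟨pos, s⟩, .update q => ∃ f, f s = enc q ∧
      pos = .run (.assign stateVar f :: M.loop enc A G' v)
  | ⟨pos, s⟩, .last q => s stateVar = enc q ∧ (∃ l, M.move v q = .halt l) ∧
      pos = .run (M.loop enc A G' v).tail
  | ⟨pos, s⟩, .done q => pos = .run [] ∧ ∃ l, M.move v q = .halt l ∧ s leader = .name l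

variable {M enc A G'}

theorem notClosed_eq_nil (henc : Function.Injective enc) (hfit : M.Fits G') {s : Store N} {q : Q}
    {v : N} (h : s stateVar = enc q) :
    notClosed s (M.branches enc A G' v) = [] ↔ ∃ l, M.move v q = .halt l := by
  have hr := read_eq henc h
  rw [notClosed, List.filter_eq_nil_iff]
  constructor
  · intro hb
    rcases hm : M.move v q with _ | ⟨w, m⟩ | L | l
    · refine absurd ?_ (hb _ ((M.mem_branches enc A G').2 (Or.inl ⟨1, rfl⟩)))
      simp [innerBranch, hr, hm, one_mem]
    · refine absurd ?_ (hb _ ((M.mem_branches enc A G').2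
        (Or.inr (Or.inl ⟨w, hfit.send v q w m hm, rfl⟩))))
      simp [sendBranch, hr, hm]
    · obtain ⟨⟨w, hw⟩, hL⟩ := hfit.listen v q L hm
      refine absurd ?_ (hb _ ((M.mem_branches enc A G').2
        (Or.inr (Or.inr ⟨w, 1, hL w hw, rfl⟩))))
      simp [recvBranch, hr, hm, one_mem, hw]
    · exact ⟨l, rfl⟩
  · rintro ⟨l, hl⟩ b hb
    rcases (M.mem_branches enc A G').1 hb with ⟨τ, rfl⟩ | ⟨w, -, rfl⟩ | ⟨w, τ, -, rfl⟩
    · simp [innerBranch, hr, hl]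
    · simp [sendBranch, hr, hl]
    · simp [recvBranch, hr, hl]

/-- Every step of the program is a step between control points. -/
theorem At.step (henc : Function.Injective enc) (hfit : M.Fits G') {v : N} {c : Code N Q}
    {p p' : PState N} {a : Action N} (h : M.At enc A G' v p c) (hs : PStep p a p') :
    ∃ c', M.CStep enc A v c a c' ∧ M.At enc A G' v p' c' := by
  obtain ⟨pos, s⟩ := p
  cases c with
  | start =>
    cases h
    cases hs
    exact ⟨_, .start, Store.write_self .., rfl⟩
  | head q =>
    obtain ⟨hq, rfl⟩ := h
    cases hs with
    | rep _ _ _ hne =>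
      have hm : ∀ l, M.move v q ≠ .halt l := fun l hl =>
        hne ((notClosed_eq_nil henc hfit hq).2 ⟨l, hl⟩)
      exact ⟨_, .guards q hm, hq, hm, rfl⟩
    | exit _ _ _ he =>
      obtain ⟨l, hl⟩ := (notClosed_eq_nil henc hfit hq).1 he
      exact ⟨_, .exit q l hl, hq, ⟨l, hl⟩, rfl⟩
  | await q =>
    obtain ⟨hq, hm, rfl⟩ := h
    have hr := read_eq henc hq
    cases hs with
    | choose _ _ _ b hb hc =>
      obtain ⟨hb, ho⟩ := List.mem_filter.1 hb
      rcases (M.mem_branches enc A G').1 hb with ⟨τ, rfl⟩ | ⟨w, hw, rfl⟩ | ⟨w, τ, -, rfl⟩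
      · simp only [innerBranch, decide_eq_true_eq] at ho
        obtain ⟨hτ, hi⟩ := ho
        refine ⟨_, .inner q τ (hr ▸ hi) hτ, _, ?_, rfl⟩
        simp only [hr]
      · simp only [sendBranch, decide_eq_true_eq] at ho
        obtain ⟨m, hm'⟩ := ho
        rw [hr] at hm'
        exact ⟨_, .choose q w m hm', hq, ⟨m, hm'⟩, rfl⟩
      · cases hc
    | guard_recv _ _ _ b w x d hb hc =>
      obtain ⟨hb, ho⟩ := List.mem_filter.1 hb
      rcases (M.mem_branches enc A G').1 hb with ⟨τ, rfl⟩ | ⟨w, hw, rfl⟩ | ⟨w, τ, -, rfl⟩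
      · cases hc
      · cases hc
      · cases hc
        simp only [recvBranch, decide_eq_true_eq] at ho
        obtain ⟨hτ, L, hL, hw⟩ := ho
        rw [hr] at hL
        refine ⟨_, .recv q L w d τ hL hw hτ, _, ?_, rfl⟩
        have : (s.write inboxVar d) stateVar = enc q := by
          rw [Store.write_of_ne _ _ stateVar_ne_inboxVar, hq]
        simp only [read_eq henc this, Store.write_self]
    | guard_send _ _ _ b w e hb hc =>
      obtain ⟨hb, ho⟩ := List.mem_filter.1 hb
      rcases (M.mem_branches enc A G').1 hb with ⟨τ, rfl⟩ | ⟨w, hw, rfl⟩ | ⟨w, τ, -, rfl⟩ <;>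
        cases hc
  | output q w =>
    obtain ⟨hq, ⟨m, hm⟩, rfl⟩ := h
    have hr := read_eq henc hq
    cases hs with
    | send =>
      have : Move.payload (M.move v (read enc s)) = m := by rw [hr, hm]; rfl
      refine ⟨.update (M.sent v q), ?_, _, ?_, rfl⟩
      · simp only [this]
        exact .send q w m hm
      · simp only [hr]
  | update q =>
    obtain ⟨f, hf, rfl⟩ := h
    cases hs with
    | assign =>
      rw [hf]
      exact ⟨_, .update q, Store.write_self .., rfl⟩
  | last q =>
    obtain ⟨hq, ⟨l, hl⟩, rfl⟩ := h
    have hr := read_eq henc hq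
    cases hs with
    | assign =>
      have : Move.result (M.move v (read enc s)) = .name l := by rw [hr, hl]; rfl
      simp only [this]
      exact ⟨_, .last q l hl, rfl, l, hl, Store.write_self ..⟩
  | done q => exact absurd hs (no_step_of_finished h.1)

/-- Every step between control points can be performed by the program. -/
theorem CStep.exists_step (henc : Function.Injective enc) (hfit : M.Fits G') {v : N}
    {c c' : Code N Q} {p : PState N} {a : Action N} (hs : M.CStep enc A v c a c')
    (h : M.At enc A G' v p c) : ∃ p', PStep p a p' ∧ M.At enc A G' v p' c' := by
  obtain ⟨pos, s⟩ := p
  cases hs with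
  | start =>
    cases h
    exact ⟨_, .assign .., Store.write_self .., rfl⟩
  | guards q hm =>
    obtain ⟨hq, rfl⟩ := h
    refine ⟨_, .rep _ _ _ fun he => ?_, hq, hm, rfl⟩
    obtain ⟨l, hl⟩ := (notClosed_eq_nil henc hfit hq).1 he
    exact hm l hl
  | exit q l hl =>
    obtain ⟨hq, rfl⟩ := h
    exact ⟨_, .exit _ _ _ ((notClosed_eq_nil henc hfit hq).2 ⟨l, hl⟩), hq, ⟨l, hl⟩, rfl⟩
  | inner q τ hm hτ =>
    obtain ⟨hq, -, rfl⟩ := h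
    have hr := read_eq henc hq
    refine ⟨_, .choose _ _ _ (M.innerBranch enc A v τ) (List.mem_filter.2
      ⟨(M.mem_branches enc A G').2 (Or.inl ⟨τ, rfl⟩), ?_⟩) rfl, _, ?_, rfl⟩
    · simp [innerBranch, hr, hm, hτ]
    · simp only [hr]
  | choose q w m hm =>
    obtain ⟨hq, -, rfl⟩ := h
    have hr := read_eq henc hq
    refine ⟨_, .choose _ _ _ (M.sendBranch enc v w) (List.mem_filter.2
      ⟨(M.mem_branches enc A G').2 (Or.inr (Or.inl ⟨w, hfit.send v q w m hm, rfl⟩)), ?_⟩) rfl,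
      hq, ⟨m, hm⟩, rfl⟩
    simp [sendBranch, hr, hm]
  | send q w m hm =>
    obtain ⟨hq, -, rfl⟩ := h
    have hr := read_eq henc hq
    have : m = Move.payload (M.move v (read enc s)) := by rw [hr, hm]; rfl
    subst this
    exact ⟨_, .send .., _, by simp only [hr], rfl⟩
  | recv q L w d τ hL hw hτ =>
    obtain ⟨hq, -, rfl⟩ := h
    have hr := read_eq henc hq
    refine ⟨_, .guard_recv _ _ _ (M.recvBranch enc A v w τ) w inboxVar d (List.mem_filter.2
      ⟨(M.mem_branches enc A G').2
        (Or.inr (Or.inr ⟨w, τ, (hfit.listen v q L hL).2 w hw, rfl⟩)), ?_⟩) rfl, _, ?_, rfl⟩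
    · simp [recvBranch, hr, hL, hτ, hw]
    · have : (s.write inboxVar d) stateVar = enc q := by
        rw [Store.write_of_ne _ _ stateVar_ne_inboxVar, hq]
      simp only [read_eq henc this, Store.write_self]
  | update q =>
    obtain ⟨f, hf, rfl⟩ := h
    refine ⟨⟨.run (M.loop enc A G' v), s.write stateVar (enc q)⟩, ?_, Store.write_self .., rfl⟩
    rw [← hf]
    exact .assign ..
  | last q l hl =>
    obtain ⟨hq, -, rfl⟩ := h
    have hr := read_eq henc hq
    have : Move.result (M.move v (read enc s)) = .name l := by rw [hr, hl]; rfl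
    refine ⟨⟨.run [], s.write leader (.name l)⟩, ?_, rfl, l, hl, Store.write_self ..⟩
    rw [← this]
    exact .assign _ (fun s => Move.result (M.move v (read enc s))) _ _

theorem At.path (henc : Function.Injective enc) (hfit : M.Fits G') {v : N}
    {p p' : PState N} {l : List (Action N)} (hs : Path PStep p l p') {c : Code N Q}
    (h : M.At enc A G' v p c) :
    ∃ c', Path (M.CStep enc A v) c l c' ∧ M.At enc A G' v p' c' := by
  induction hs generalizing c with
  | nil => exact ⟨c, .nil _, h⟩
  | cons hs _ ih =>
    obtain ⟨c₁, hc₁, h₁⟩ := h.step henc hfit hs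
    obtain ⟨c₂, hc₂, h₂⟩ := ih h₁
    exact ⟨c₂, .cons hc₁ hc₂, h₂⟩

theorem exists_path (henc : Function.Injective enc) (hfit : M.Fits G') {v : N}
    {c c' : Code N Q} {l : List (Action N)} (hs : Path (M.CStep enc A v) c l c') {p : PState N}
    (h : M.At enc A G' v p c) : ∃ p', Path PStep p l p' ∧ M.At enc A G' v p' c' := by
  induction hs generalizing p with
  | nil => exact ⟨p, .nil _, h⟩
  | cons hs _ ih =>
    obtain ⟨p₁, hp₁, h₁⟩ := hs.exists_step henc hfit h
    obtain ⟨p₂, hp₂, h₂⟩ := ih h₁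
    exact ⟨p₂, .cons hp₁ hp₂, h₂⟩

theorem at_init (v : N) : M.At enc A G' v ((M.toSystem enc A G').init v) .start := rfl

/-! ### Symmetry of the implementation -/

theorem At.finished {v : N} {p : PState N} {c : Code N Q} (h : M.At enc A G' v p c)
    (hp : p.pos = .run []) : ∃ q, c = .done q := by
  obtain ⟨pos, s⟩ := p
  obtain rfl : pos = .run [] := hp
  cases c with
  | start => simp [At, toSystem] at h
  | head q => simp [At, loop] at h
  | await q => simp [At] at h
  | output q w => simp [At, sendBranch] at h
  | update q => simp [At] at h
  | last q => simp [At, loop] at h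
  | done q => exact ⟨q, rfl⟩

/-- Each process can imitate the steps of the process of which it is the image, and processes
interact only through the actions they perform. -/
theorem complete_rename_toSystem (henc : Function.Injective enc) (hfit : M.Fits G')
    (hM : M.IsSymm A) (hsmul : ∀ (σ : Equiv.Perm N) (q : Q), enc (σ • q) = (enc q).rename σ)
    {σ : Equiv.Perm N} (hσ : σ ∈ A) {es : List (Event N)}
    (h : Complete (M.toSystem enc A G') es) :
    Complete (M.toSystem enc A G') (es.map (Event.rename σ)) := by
  obtain ⟨s, hs, hf⟩ := h
  have key : ∀ v, ∃ p, Path PStep ((M.toSystem enc A G').init v)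
      (proj v (es.map (Event.rename σ))) p ∧ p.pos = .run [] := by
    intro u
    obtain ⟨v, rfl⟩ := σ.surjective u
    obtain ⟨c, hc, hat⟩ := (M.at_init v).path henc hfit (path_proj hs v)
    obtain ⟨q, rfl⟩ := hat.finished (hf v)
    obtain ⟨p, hp, hat'⟩ := exists_path henc hfit (path_rename hM hsmul hσ hc) (M.at_init (σ v))
    exact ⟨p, proj_rename σ v es ▸ hp, hat'.1⟩
  choose t ht hft using key
  refine ⟨t, path_of_proj ?_ _ ht, hft⟩
  simp only [List.mem_map]
  rintro _ ⟨e, he, rfl⟩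
  exact (path_wf hs e he).rename σ

end Machine

end CSP

namespace CSP

namespace Machine

/-! ### Termination of the implementation -/

variable {N Q : Type*}

/-- The state of the machine at a control point; `q₀` is the initial state. -/
def Code.state (q₀ : Q) : Code N Q → Q
  | .start => q₀
  | .head q => q
  | .await q => q
  | .output q _ => q
  | .update q => q
  | .last q => q
  | .done q => q

/-- A bound for the number of steps of the program before the machine has to move. -/
def Code.rank : Code N Q → ℕ
  | .start => 4
  | .head _ => 3
  | .await _ => 2
  | .output _ _ => 1
  | .update _ => 4
  | .last _ => 1
  | .done _ => 0

variable [MulAction (Equiv.Perm N) Q] {M : Machine N Q} {enc : Q → Val N}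
  {A : Subgroup (Equiv.Perm N)}

/-- A local step of the program leads closer to the next move of the machine, or it is an inner move
of the machine. -/
theorem CStep.of_isLocal {v : N} {c c' : Code N Q} {a : Action N} (h : M.CStep enc A v c a c')
    (ha : a.IsLocal) :
    (c'.state (M.init v) = c.state (M.init v) ∧ c'.rank < c.rank) ∨
      ∃ τ ∈ A, M.move v (c.state (M.init v)) = .inner ∧
        c'.state (M.init v) = M.pickInner τ v (c.state (M.init v)) := by
  cases h with
  | inner q τ h hτ => exact Or.inr ⟨τ, hτ, h, rfl⟩
  | send | recv => exact ha.elim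
  | start | guards | exit | choose | update | last => exact Or.inl ⟨rfl, by simp [Code.rank]⟩

variable [Nonempty Q] [Finite N] {G' : Digraph N}

/-- What the program of a process can do when it is not able to make a local step. -/
theorem At.blocked (henc : Function.Injective enc) (hfit : M.Fits G') {v : N} {p : PState N}
    {c : Code N Q} (h : M.At enc A G' v p c)
    (hloc : ∀ a p', a.IsLocal → ¬ PStep p a p') :
    M.move v (c.state (M.init v)) ≠ .inner ∧
    (∀ w m, M.move v (c.state (M.init v)) = .send w m → ∃ p', PStep p (.send w m) p') ∧
    (∀ L, M.move v (c.state (M.init v)) = .listen L →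
      ∀ w ∈ L, ∀ d, ∃ p', PStep p (.recv w inboxVar d) p') ∧
    (∀ l, M.move v (c.state (M.init v)) = .halt l →
      p.pos = .run [] ∧ p.store leader = .name l) := by
  have no : ∀ {a c'}, M.CStep enc A v c a c' → ¬ a.IsLocal := fun {a c'} hs ha => by
    obtain ⟨p', hp', -⟩ := hs.exists_step henc hfit h
    exact hloc a p' ha hp'
  cases c with
  | start => exact absurd trivial (no .start)
  | head q =>
    by_cases hq : ∃ l, M.move v q = .halt l
    · obtain ⟨l, hl⟩ := hq
      exact absurd trivial (no (.exit q l hl))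
    · exact absurd trivial (no (.guards q (not_exists.1 hq)))
  | await q =>
    refine ⟨fun hm => no (.inner q 1 hm (one_mem _)) trivial,
      fun w m hm => absurd trivial (no (.choose q w m hm)), fun L hL w hw d => ?_,
      fun l hl => absurd hl (by cases p; exact h.2.1 l)⟩
    obtain ⟨p', hp', -⟩ :=
      (CStep.recv (enc := enc) q L w d 1 hL hw (one_mem A)).exists_step henc hfit h
    exact ⟨p', hp'⟩
  | output q w =>
    obtain ⟨m, hm⟩ : ∃ m, M.move v q = .send w m := by cases p; exact h.2.1
    simp only [Code.state, hm]
    refine ⟨by simp, ?_, by simp, by simp⟩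
    rintro _ _ ⟨⟩
    obtain ⟨p', hp', -⟩ :=
      (CStep.send (enc := enc) (A := A) q w m hm).exists_step henc hfit h
    exact ⟨p', hp'⟩
  | update q => exact absurd trivial (no (.update q))
  | last q =>
    obtain ⟨l, hl⟩ : ∃ l, M.move v q = .halt l := by cases p; exact h.2.1
    exact absurd trivial (no (.last q l hl))
  | done q =>
    obtain ⟨hp, l, hl, hlead⟩ : p.pos = .run [] ∧ ∃ l, M.move v q = .halt l ∧
        p.store leader = .name l := by cases p; exact h
    simp only [Code.state, hl]
    refine ⟨by simp, by simp, by simp, ?_⟩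
    rintro _ ⟨⟩
    exact ⟨hp, hlead⟩

open Classical in
/-- The implementation is electoral if every move of the machine decreases a well-founded measure
while an invariant is kept, and if the machine gets stuck only with all processes announcing the
same leader. -/
theorem toSystem_isElectoral (henc : Function.Injective enc) (hfit : M.Fits G')
    (hM : M.IsSymm A) {α : Type*} [Preorder α] [WellFoundedLT α] (Inv : (N → Q) → α → Prop)
    (hinit : ∃ k, Inv M.init k)
    (hinner : ∀ q k v, Inv q k → M.move v (q v) = .inner →
      (∃ q', M.innerR v (q v) q') ∧
      ∀ q', M.innerR v (q v) q' → ∃ k' < k, Inv (Function.update q v q') k')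
    (hcomm : ∀ q k v w m L, Inv q k → v ≠ w → M.move v (q v) = .send w m →
      M.move w (q w) = .listen L → v ∈ L → (∃ q', M.recvR w (q w) v m q') ∧
      ∀ q', M.recvR w (q w) v m q' → ∃ k' < k,
        Inv (Function.update (Function.update q v (M.sent v (q v))) w q') k')
    (hstuck : ∀ q k, Inv q k → (∀ v, M.move v (q v) ≠ .inner) →
      (∀ v w m L, v ≠ w → M.move v (q v) = .send w m → M.move w (q w) = .listen L → v ∉ L) →
      ∃ l, ∀ v, M.move v (q v) = .halt l) :
    (M.toSystem enc A G').IsElectoral := by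
  intro C
  cases nonempty_fintype N
  let st : (N → Code N Q) → N → Q := fun c v => (c v).state (M.init v)
  have hst : ∀ c v c', st (Function.update c v c') =
      Function.update (st c) v (c'.state (M.init v)) := by
    intro c v c'
    funext u
    by_cases hu : u = v
    · subst hu
      simp [st]
    · simp [st, hu]
  suffices key : ∀ (k : α) (r n : ℕ) (c : N → Code N Q),
      (∀ v, M.At enc A G' v (C.state n v) (c v)) → Inv (st c) k → ∑ v, (c v).rank = r →
      ∃ n, C.event n = none ∧ Finished (C.state n) ∧
        ∃ w : N, ∀ v, (C.state n v).store leader = .name w by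
    obtain ⟨k, hk⟩ := hinit
    exact key k _ 0 (fun _ => .start) (fun v => by rw [C.start]; exact M.at_init v) hk rfl
  intro k
  induction k using WellFoundedLT.induction with
  | ind k ihk =>
  intro r
  induction r using Nat.strong_induction_on with
  | _ r ihr =>
  intro n c hat hinv hr
  rcases he : C.event n with _ | e
  · -- no step is possible
    have hno := (C.ended n he).1
    have hb := fun v => (hat v).blocked henc hfit fun a p' ha hp => hno _ _ (.loc _ v a p' ha hp)
    obtain ⟨l, hl⟩ := hstuck _ _ hinv (fun v => (hb v).1) fun v w m L hvw hm hL hv => by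
      obtain ⟨t, ht⟩ := (hb v).2.1 w m hm
      obtain ⟨u, hu⟩ := (hb w).2.2.1 L hL v hv m
      exact hno _ _ (.comm _ v w _ m t u hvw ht hu)
    exact ⟨n, he, fun v => ((hb v).2.2.2 l (hl v)).1, l, fun v => ((hb v).2.2.2 l (hl v)).2⟩
  · have hs := C.next n e he
    generalize hs' : C.state (n + 1) = s' at hs
    cases hs with
    | loc v a t ha ht =>
      obtain ⟨c', hc', hat'⟩ := (hat v).step henc hfit ht
      have hat₁ : ∀ u, M.At enc A G' u (C.state (n + 1) u) (Function.update c v c' u) := by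
        intro u
        rw [hs']
        by_cases hu : u = v
        · subst hu
          rwa [Function.update_self, Function.update_self]
        · rw [Function.update_of_ne hu, Function.update_of_ne hu]
          exact hat u
      rcases hc'.of_isLocal ha with ⟨h₁, h₂⟩ | ⟨τ, hτ, h₁, h₂⟩
      · refine ihr _ ?_ (n + 1) _ hat₁ ?_ rfl
        · rw [← hr]
          refine Finset.sum_lt_sum (fun u _ => ?_) ⟨v, Finset.mem_univ v, by simpa using h₂⟩
          by_cases hu : u = v
          · subst hu
            simpa using h₂.le
          · simp [hu]
        · rw [hst, h₁]
          simpa [st] using hinv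
      · obtain ⟨hex, hk⟩ := hinner _ _ v hinv h₁
        obtain ⟨k', hk', hinv'⟩ := hk _ (hM.pickInner hτ hex)
        exact ihk k' hk' _ (n + 1) _ hat₁ (by rwa [hst, h₂]) rfl
    | comm v w x d t u hvw ht hu =>
      obtain ⟨c₁, hc₁, hat₁⟩ := (hat v).step henc hfit ht
      obtain ⟨c₂, hc₂, hat₂⟩ := (hat w).step henc hfit hu
      have hat₃ : ∀ u', M.At enc A G' u' (C.state (n + 1) u')
          (Function.update (Function.update c v c₁) w c₂ u') := by
        intro u'
        rw [hs']
        by_cases hu : u' = w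
        · subst hu
          rwa [Function.update_self, Function.update_self]
        · rw [Function.update_of_ne hu, Function.update_of_ne hu]
          by_cases hu : u' = v
          · subst hu
            rwa [Function.update_self, Function.update_self]
          · rw [Function.update_of_ne hu, Function.update_of_ne hu]
            exact hat u'
      have h₁ : M.move v (st c v) = .send w d ∧ c₁.state (M.init v) = M.sent v (st c v) := by
        simp only [st]
        generalize c v = cv at hc₁
        cases hc₁ with
        | send _ _ _ h => exact ⟨h, rfl⟩
      have h₂ : ∃ L τ, M.move w (st c w) = .listen L ∧ v ∈ L ∧ τ ∈ A ∧
          c₂.state (M.init w) = M.pickRecv τ w (st c w) v d := by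
        simp only [st]
        generalize c w = cw at hc₂
        cases hc₂ with
        | recv _ L _ _ τ h h' h'' => exact ⟨L, τ, h, h', h'', rfl⟩
      obtain ⟨L, τ, hL, hv, hτ, h₂⟩ := h₂
      obtain ⟨hex, hk⟩ := hcomm _ _ v w d L hinv hvw h₁.1 hL hv
      obtain ⟨k', hk', hinv'⟩ := hk _ (hM.pickRecv hτ hex)
      exact ihk k' hk' _ (n + 1) _ hat₃ (by rwa [hst, hst, h₁.2, h₂]) rfl

end Machine

end CSP

namespace CSP

variable {N : Type*}

/-! ### Encoding of the states of the election protocol -/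

/-- The phase of a process in the election protocol. In the first three cases the process executes
the given system; `h` is the list of the actions it has performed, and `dead` tells that it has
lost the election. -/
inductive Phase (N : Type*)
  /-- to decide on the next action -/
  | work (h : List (Action N)) (dead : Bool) : Phase N
  /-- committed to sending `d` to `w` -/
  | commit (h : List (Action N)) (dead : Bool) (w : N) (d : Val N) : Phase N
  /-- waiting for a message -/
  | wait (h : List (Action N)) (dead : Bool) : Phase N
  /-- the process has completed its part of the given system -/
  | ready : Phase N
  /-- the process has learned that `l` is the leader and has nothing left to do -/
  | halted (l : N) : Phase N

/-- The state of a process in the election protocol: its phase, and the token if it holds it. The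
token consists of the name of the leader and the rest of the route along which it is passed on. -/
structure LState (N : Type*) where
  phase : Phase N
  tok : Option (N × List N)

/-- Renaming of the processes in a phase. -/
def Phase.rename (σ : Equiv.Perm N) : Phase N → Phase N
  | .work h b => .work (h.map (Action.rename σ)) b
  | .commit h b w d => .commit (h.map (Action.rename σ)) b (σ w) (d.rename σ)
  | .wait h b => .wait (h.map (Action.rename σ)) b
  | .ready => .ready
  | .halted l => .halted (σ l)

theorem Phase.rename_one (p : Phase N) : p.rename 1 = p := by
  have : (Action.rename 1 : Action N → Action N) = id := funext Action.rename_one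
  cases p <;> simp [Phase.rename, this, Val.rename_one]

theorem Phase.rename_mul (σ τ : Equiv.Perm N) (p : Phase N) :
    p.rename (σ * τ) = (p.rename τ).rename σ := by
  have : (Action.rename (σ * τ) : Action N → Action N) = Action.rename σ ∘ Action.rename τ :=
    funext (Action.rename_mul σ τ)
  cases p <;> simp [Phase.rename, this, Val.rename_mul]

/-- Permutations of names act on states by renaming. -/
instance : MulAction (Equiv.Perm N) (LState N) where
  smul σ q := ⟨q.phase.rename σ, q.tok.map fun p => (σ p.1, p.2.map σ)⟩
  one_smul q := by
    obtain ⟨ph, tok⟩ := q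
    change LState.mk _ _ = _
    rcases tok with _ | ⟨l, r⟩ <;> simp [Phase.rename_one]
  mul_smul σ τ q := by
    obtain ⟨ph, tok⟩ := q
    change LState.mk (ph.rename _) (tok.map _) =
      LState.mk ((ph.rename τ).rename σ) ((tok.map _).map _)
    rcases tok with _ | ⟨l, r⟩ <;> simp [Phase.rename_mul]

instance : Nonempty (LState N) := ⟨⟨.ready, none⟩⟩

theorem LState.smul_mk (σ : Equiv.Perm N) (p : Phase N) (t : Option (N × List N)) :
    σ • (⟨p, t⟩ : LState N) = ⟨p.rename σ, t.map fun p => (σ p.1, p.2.map σ)⟩ := rfl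

/-- Lists as values, with `unset` for the empty list. -/
def encList {α : Type*} (f : α → Val N) : List α → Val N
  | [] => .unset
  | a :: l => .pair (f a) (encList f l)

theorem encList_injective {α : Type*} {f : α → Val N} (hf : Function.Injective f) :
    Function.Injective (encList f) := by
  intro l
  induction l with
  | nil => rintro (_ | ⟨b, m⟩) h <;> simp_all [encList]
  | cons a l ih =>
    rintro (_ | ⟨b, m⟩) h
    · simp [encList] at h
    · simp only [encList, Val.pair.injEq] at h
      rw [hf h.1, ih h.2]

theorem encList_map {α : Type*} {f : α → Val N} {g : α → α} {σ : Equiv.Perm N}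
    (hf : ∀ a, f (g a) = (f a).rename σ) (l : List α) :
    encList f (l.map g) = (encList f l).rename σ := by
  induction l with
  | nil => rfl
  | cons a l ih => simp only [List.map_cons, encList, Val.rename, ih, hf]

theorem name_injective : Function.Injective (Val.name : N → Val N) := fun _ _ h => by
  simpa using h

/-- Variables as values. -/
def encVar (x : Var N) : Val N := .pair (.num x.ident) (encList .name x.index)

theorem encVar_injective : Function.Injective (encVar (N := N)) := by
  rintro ⟨i, l⟩ ⟨j, m⟩ h
  simp only [encVar, Val.pair.injEq, Val.num.injEq, Nat.cast_inj] at h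
  rw [h.1, encList_injective name_injective h.2]

theorem encVar_rename (σ : Equiv.Perm N) (x : Var N) :
    encVar (x.rename σ) = (encVar x).rename σ := by
  simp only [encVar, Var.rename, Val.rename]
  rw [encList_map (f := Val.name) (σ := σ) fun _ => rfl]

/-- Actions as values. -/
def encAction : Action N → Val N
  | .skip => .num 0
  | .guards => .num 1
  | .exit => .num 2
  | .choose => .num 3
  | .assign x d => .pair (.num 0) (.pair (encVar x) d)
  | .send w d => .pair (.num 1) (.pair (.name w) d)
  | .recv w x d => .pair (.num 2) (.pair (.name w) (.pair (encVar x) d))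

theorem encAction_injective : Function.Injective (encAction (N := N)) := by
  intro a b h
  cases a <;> cases b <;> simp_all [encAction, encVar_injective.eq_iff]

theorem encAction_rename (σ : Equiv.Perm N) (a : Action N) :
    encAction (a.rename σ) = (encAction a).rename σ := by
  cases a <;> simp [encAction, Action.rename, Val.rename, encVar_rename]

/-- Phases as values. -/
def encPhase : Phase N → Val N
  | .work h b => .pair (.num 0) (.pair (encList encAction h) (.bool b))
  | .commit h b w d =>
      .pair (.num 1) (.pair (encList encAction h) (.pair (.bool b) (.pair (.name w) d)))
  | .wait h b => .pair (.num 2) (.pair (encList encAction h) (.bool b))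
  | .ready => .num 0
  | .halted l => .name l

theorem encPhase_injective : Function.Injective (encPhase (N := N)) := by
  intro a b h
  cases a <;> cases b <;> simp_all [encPhase, (encList_injective encAction_injective).eq_iff]

theorem encPhase_rename (σ : Equiv.Perm N) (p : Phase N) :
    encPhase (p.rename σ) = (encPhase p).rename σ := by
  cases p <;> simp [encPhase, Phase.rename, Val.rename, encList_map (encAction_rename σ)]

/-- The message that hands over the token: the leader `l` and the remaining route `r`. -/
def tokMsg (l : N) (r : List N) : Val N := .pair (.name l) (encList .name r)

/-- A message of the given system, with the information whether the sender is alive. -/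
def dataMsg (alive : Bool) (d : Val N) : Val N := .pair (.bool alive) d

theorem tokMsg_inj {l l' : N} {r r' : List N} : tokMsg l r = tokMsg l' r' ↔ l = l' ∧ r = r' := by
  simp [tokMsg, (encList_injective name_injective).eq_iff]

theorem tokMsg_rename (σ : Equiv.Perm N) (l : N) (r : List N) :
    (tokMsg l r).rename σ = tokMsg (σ l) (r.map σ) := by
  simp only [tokMsg, Val.rename]
  rw [encList_map (f := Val.name) (σ := σ) fun _ => rfl]

/-- States of the protocol as values. -/
def encState (q : LState N) : Val N :=
  .pair (encPhase q.phase)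
    (match q.tok with
    | none => .unset
    | some p => tokMsg p.1 p.2)

theorem encState_injective : Function.Injective (encState (N := N)) := by
  rintro ⟨p, t⟩ ⟨p', t'⟩ h
  simp only [encState, Val.pair.injEq] at h
  obtain ⟨h₁, h₂⟩ := h
  rw [encPhase_injective h₁]
  rcases t with _ | ⟨l, r⟩ <;> rcases t' with _ | ⟨l', r'⟩
  · rfl
  · simp [tokMsg] at h₂
  · simp [tokMsg] at h₂
  · simp only [tokMsg_inj] at h₂
    rw [h₂.1, h₂.2]

theorem encState_smul (σ : Equiv.Perm N) (q : LState N) :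
    encState (σ • q) = (encState q).rename σ := by
  obtain ⟨p, t⟩ := q
  rw [LState.smul_mk]
  rcases t with _ | ⟨l, r⟩ <;> simp [encState, Val.rename, encPhase_rename, tokMsg_rename]

/-! ### The election protocol -/

section protocol

variable (P : System N) (V : Set N) (G' : Digraph N)

/-- `h` is the list of the actions of `v` in some execution of the system. -/
def Trace (v : N) (h : List (Action N)) : Prop := ∃ es, Feasible P es ∧ proj v es = h

/-- `h` is the list of the actions of `v` in some complete execution of the system. -/
def FullTrace (v : N) (h : List (Action N)) : Prop := ∃ es, Complete P es ∧ proj v es = h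

/-- `r` is a walk in the network that starts with a successor of `v` and visits all other
processes. -/
def Route (v : N) (r : List N) : Prop := (v :: r).IsChain G'.Adj ∧ ∀ u, u ≠ v → u ∈ r

/-- The processes from which `v` can receive in the given system after the actions `h`. -/
def sources (v : N) (h : List (Action N)) : Set N :=
  {w | G'.Adj w v ∧ ∃ x d, Trace P v (h ++ [.recv w x d])}

open Classical in
/-- The next move of a process. The alternative `inner` of the case distinctions does not arise in
reachable states; it makes sure that the machine communicates along edges only. -/
noncomputable def electionMove (v : N) : LState N → Move N
  | ⟨.work _ _, _⟩ => .inner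
  | ⟨.commit _ b w d, _⟩ => if G'.Adj v w then .send w (dataMsg (!b) d) else .inner
  | ⟨.wait h _, _⟩ =>
      if (sources P G' v h).Nonempty then .listen (sources P G' v h) else .inner
  | ⟨.ready, none⟩ => if {w | G'.Adj w v}.Nonempty then .listen {w | G'.Adj w v} else .inner
  | ⟨.ready, some (_, [])⟩ => .inner
  | ⟨.ready, some (l, w :: r)⟩ => if G'.Adj v w then .send w (tokMsg l r) else .inner
  | ⟨.halted l, _⟩ => .halt l

/-- A process executing the given system may perform a local action, commit itself to an output, or
finish; it may wait only if its actions so far admit no continuation but inputs. A process that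
finishes alive creates the token. -/
def electionInner (v : N) : LState N → LState N → Prop
  | ⟨.work h b, t⟩, q' =>
      (∃ a, a.IsLocal ∧ Trace P v (h ++ [a]) ∧ q' = ⟨.work (h ++ [a]) b, t⟩) ∨
      (∃ w d, Trace P v (h ++ [.send w d]) ∧ q' = ⟨.commit h b w d, t⟩) ∨
      (FullTrace P v h ∧ b = true ∧ q' = ⟨.ready, t⟩) ∨
      (FullTrace P v h ∧ b = false ∧ ∃ r, Route G' v r ∧ q' = ⟨.ready, some (v, r)⟩) ∨
      ((∀ a, Trace P v (h ++ [a]) → ∃ w x d, a = .recv w x d) ∧ ¬ FullTrace P v h ∧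
        q' = ⟨.wait h b, t⟩)
  | ⟨.ready, t⟩, q' => ∃ l, t = some (l, []) ∧ q' = ⟨.halted l, none⟩
  | _, _ => False

/-- The token is kept until it is needed. A message of the given system from a process that is alive
makes the receiver dead. -/
def electionRecv (v : N) (q : LState N) (w : N) (m : Val N) (q' : LState N) : Prop :=
  (∃ l r, m = tokMsg l r ∧ ((∃ h b, q.phase = .wait h b) ∨ q.phase = .ready) ∧
    q' = ⟨q.phase, some (l, r)⟩) ∨
  ∃ h b alive d x, m = dataMsg alive d ∧ q.phase = .wait h b ∧ Trace P v (h ++ [.recv w x d]) ∧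
    q' = ⟨.work (h ++ [.recv w x d]) (b || alive), q.tok⟩

open Classical in
/-- A process passing on the token stops if the token does not come back. -/
noncomputable def electionSent (v : N) : LState N → LState N
  | ⟨.commit h b w d, t⟩ => ⟨.work (h ++ [.send w d]) b, t⟩
  | ⟨.ready, some (l, _ :: r)⟩ => if v ∈ r then ⟨.ready, none⟩ else ⟨.halted l, none⟩
  | q => q

open Classical in
/-- The election protocol built on the given system. Processes outside `V` are dead from the
beginning. -/
noncomputable def election : Machine N (LState N) where
  init v := ⟨.work [] (decide (v ∉ V)), none⟩
  move := electionMove P G'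
  innerR := electionInner P G'
  recvR := electionRecv P
  sent := electionSent

theorem election_fits : (election P V G').Fits G' := by
  constructor
  · rintro v ⟨_ | _ | _ | _ | _, _ | ⟨_, _ | _⟩⟩ w m h <;>
      simp only [election, electionMove] at h <;> (try split_ifs at h) <;> cases h <;> assumption
  · rintro v ⟨_ | _ | _ | _ | _, _ | ⟨_, _ | _⟩⟩ L h <;>
      simp only [election, electionMove] at h <;> (try split_ifs at h) <;> cases h
    all_goals exact ⟨‹_›, fun w hw => by first | exact hw.1 | exact hw⟩

variable {P V G'} {A : Subgroup (Equiv.Perm N)}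

theorem ite_congr_map {α β : Type*} {c c' : Prop} [Decidable c] [Decidable c'] (f : α → β)
    (h : c ↔ c') {x y : α} {x' y' : β} (hx : x' = f x) (hy : y' = f y) :
    (if c' then x' else y') = f (if c then x else y) := by
  subst hx hy
  by_cases hc : c
  · rw [if_pos hc, if_pos (h.1 hc)]
  · rw [if_neg hc, if_neg (mt h.2 hc)]

theorem map_snoc {α β : Type*} (f : α → β) (l : List α) (a : α) :
    (l ++ [a]).map f = l.map f ++ [f a] := by simp

/-- The protocol is as symmetric as the given system. -/
theorem election_isSymm (hP : Terminating P)
    (hcomplete : ∀ σ ∈ A, ∀ es, Complete P es → Complete P (es.map (Event.rename σ)))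
    (hadj : ∀ σ ∈ A, ∀ v w, G'.Adj v w → G'.Adj (σ v) (σ w))
    (hV : ∀ σ ∈ A, ∀ v ∈ V, σ v ∈ V) : (election P V G').IsSymm A := by
  classical
  have hfull : ∀ σ ∈ A, ∀ v h, FullTrace P v h →
      FullTrace P (σ v) (h.map (Action.rename σ)) := by
    rintro σ hσ v _ ⟨es, hes, rfl⟩
    exact ⟨_, hcomplete σ hσ es hes, proj_rename σ v es⟩
  have htrace : ∀ σ ∈ A, ∀ v h, Trace P v h → Trace P (σ v) (h.map (Action.rename σ)) := by
    rintro σ hσ v _ ⟨es, hes, rfl⟩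
    obtain ⟨es', h'⟩ := (feasible_iff hP).1 hes
    have := hcomplete σ hσ _ h'
    rw [List.map_append] at this
    exact ⟨_, (feasible_iff hP).2 ⟨_, this⟩, proj_rename σ v es⟩
  have hinv : ∀ (σ : Equiv.Perm N) (h : List (Action N)),
      (h.map (Action.rename σ)).map (Action.rename σ⁻¹) = h := by
    intro σ h
    rw [List.map_map]
    convert List.map_id h using 2
    funext a
    rw [Function.comp_apply, ← Action.rename_mul, inv_mul_cancel, Action.rename_one, id]
  have hfull' : ∀ σ ∈ A, ∀ v h, FullTrace P (σ v) (h.map (Action.rename σ)) ↔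
      FullTrace P v h := by
    refine fun σ hσ v h => ⟨fun h' => ?_, hfull σ hσ v h⟩
    simpa [hinv] using hfull σ⁻¹ (inv_mem hσ) _ _ h'
  have hadj' : ∀ σ ∈ A, ∀ v w, G'.Adj (σ v) (σ w) ↔ G'.Adj v w := by
    refine fun σ hσ v w => ⟨fun h' => ?_, hadj σ hσ v w⟩
    simpa using hadj σ⁻¹ (inv_mem hσ) _ _ h'
  have hV' : ∀ σ ∈ A, ∀ v, σ v ∈ V ↔ v ∈ V := by
    refine fun σ hσ v => ⟨fun h' => ?_, hV σ hσ v⟩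
    simpa using hV σ⁻¹ (inv_mem hσ) _ h'
  have hsrc : ∀ σ ∈ A, ∀ v h,
      sources P G' (σ v) (h.map (Action.rename σ)) = σ '' sources P G' v h := by
    intro σ hσ v h
    ext u
    obtain ⟨w, rfl⟩ := σ.surjective u
    rw [σ.injective.mem_set_image]
    refine and_congr (hadj' σ hσ w v) ⟨?_, ?_⟩
    · rintro ⟨x, d, h'⟩
      refine ⟨x.rename σ⁻¹, d.rename σ⁻¹, ?_⟩
      have := htrace σ⁻¹ (inv_mem hσ) _ _ h'
      rw [map_snoc, hinv] at this
      simpa [Action.rename] using this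
    · rintro ⟨x, d, h'⟩
      have := htrace σ hσ _ _ h'
      rw [map_snoc] at this
      exact ⟨_, _, this⟩
  have hnbr : ∀ σ ∈ A, ∀ v, {w | G'.Adj w (σ v)} = σ '' {w | G'.Adj w v} := by
    intro σ hσ v
    ext u
    obtain ⟨w, rfl⟩ := σ.surjective u
    rw [σ.injective.mem_set_image]
    exact hadj' σ hσ w v
  constructor
  · intro σ hσ v
    simp [election, LState.smul_mk, Phase.rename, hV' σ hσ]
  · rintro σ hσ v ⟨_ | ⟨h, b, w, d⟩ | ⟨h, b⟩ | _ | _, t⟩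
    · rfl
    · exact ite_congr_map (Move.rename σ) (hadj' σ hσ v w).symm rfl rfl
    · have := hsrc σ hσ v h
      refine ite_congr_map (Move.rename σ) ?_ (congrArg Move.listen this) rfl
      rw [this, Set.image_nonempty]
    · rcases t with _ | ⟨l, _ | ⟨w, r⟩⟩
      · have := hnbr σ hσ v
        refine ite_congr_map (Move.rename σ) ?_ (congrArg Move.listen this) rfl
        rw [this, Set.image_nonempty]
      · rfl
      · refine ite_congr_map (Move.rename σ) (hadj' σ hσ v w).symm ?_ rfl
        rw [Move.rename, tokMsg_rename]
    · rfl
  · rintro σ hσ v ⟨_ | ⟨h, b, w, d⟩ | ⟨h, b⟩ | _ | _, t⟩ q' hq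
    · rename_i h b
      rcases hq with ⟨a, ha, ht, rfl⟩ | ⟨w, d, ht, rfl⟩ | ⟨hf, hb, rfl⟩ | ⟨hf, hb, r, hr, rfl⟩ |
        ⟨hw, hf, rfl⟩
      · refine Or.inl ⟨a.rename σ, (Action.isLocal_rename σ a).2 ha, ?_, ?_⟩
        · rw [← map_snoc]
          exact htrace σ hσ _ _ ht
        · simp [LState.smul_mk, Phase.rename]
      · refine Or.inr (Or.inl ⟨σ w, d.rename σ, ?_, rfl⟩)
        have := htrace σ hσ _ _ ht
        rwa [map_snoc] at this
      · exact Or.inr (Or.inr (Or.inl ⟨hfull σ hσ _ _ hf, hb, rfl⟩))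
      · refine Or.inr (Or.inr (Or.inr (Or.inl ⟨hfull σ hσ _ _ hf, hb, r.map σ, ?_, rfl⟩)))
        refine ⟨?_, fun u hu => ?_⟩
        · rw [← List.map_cons, List.isChain_map]
          exact hr.1.imp fun a b => hadj σ hσ a b
        · obtain ⟨w, rfl⟩ := σ.surjective u
          exact List.mem_map.2 ⟨w, hr.2 w fun h => hu (h ▸ rfl), rfl⟩
      · refine Or.inr (Or.inr (Or.inr (Or.inr ⟨fun a ha => ?_, ?_, rfl⟩)))
        · have := htrace σ⁻¹ (inv_mem hσ) _ _ ha
          rw [map_snoc, hinv] at this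
          obtain ⟨w, x, d, hw⟩ := hw _ (by simpa using this)
          have h₂ : a = (a.rename σ⁻¹).rename σ := by
            rw [← Action.rename_mul, mul_inv_cancel, Action.rename_one]
          rw [h₂, hw]
          exact ⟨_, _, _, rfl⟩
        · rwa [hfull' σ hσ]
    · exact hq.elim
    · exact hq.elim
    · obtain ⟨l, rfl, rfl⟩ := hq
      exact ⟨σ l, rfl, rfl⟩
    · exact hq.elim
  · rintro σ hσ v ⟨p, t⟩ w m q' (⟨l, r, rfl, hp, rfl⟩ | ⟨h, b, alive, d, x, rfl, hp, ht, rfl⟩)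
    · refine Or.inl ⟨σ l, r.map σ, tokMsg_rename .., ?_, rfl⟩
      rcases hp with ⟨h, b, hp⟩ | hp
      · obtain rfl : p = _ := hp
        exact Or.inl ⟨_, _, rfl⟩
      · obtain rfl : p = _ := hp
        exact Or.inr rfl
    · obtain rfl : p = _ := hp
      have := htrace σ hσ _ _ ht
      rw [map_snoc] at this
      refine Or.inr ⟨_, b, alive, d.rename σ, x.rename σ, rfl, rfl, this, ?_⟩
      simp [LState.smul_mk, Phase.rename, Action.rename]
  · rintro σ hσ v ⟨_ | ⟨h, b, w, d⟩ | ⟨h, b⟩ | _ | _, t⟩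
    · rfl
    · simp [election, LState.smul_mk, Phase.rename, electionSent, Action.rename]
    · rfl
    · rcases t with _ | ⟨l, _ | ⟨w, r⟩⟩
      · rfl
      · rfl
      · exact ite_congr_map (σ • ·) (List.mem_map_of_injective σ.injective).symm rfl rfl
    · rfl

end protocol

end CSP

namespace CSP

variable {N : Type*} {P : System N} {V : Set N} {G' : Digraph N}

/-! ### Traces of the given system -/

theorem actionOf_eq_send {e : Event N} (he : e.WF) {v w : N} {d : Val N}
    (h : e.actionOf v = some (.send w d)) : ∃ x, e = .comm v w x d := by
  cases e with
  | loc u a =>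
    by_cases hu : v = u
    · subst hu
      rw [actionOf_loc_self] at h
      cases h
      exact he.elim
    · rw [actionOf_loc_ne a hu] at h
      cases h
  | comm u u' x d' =>
    by_cases hu : v = u
    · subst hu
      rw [actionOf_comm_left] at h
      cases h
      exact ⟨x, rfl⟩
    · by_cases hu' : v = u'
      · subst hu'
        rw [actionOf_comm_right x d' he] at h
        cases h
      · rw [actionOf_comm_ne x d' hu hu'] at h
        cases h

theorem actionOf_eq_recv {e : Event N} (he : e.WF) {v w : N} {x : Var N} {d : Val N}
    (h : e.actionOf v = some (.recv w x d)) : e = .comm w v x d := by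
  cases e with
  | loc u a =>
    by_cases hu : v = u
    · subst hu
      rw [actionOf_loc_self] at h
      cases h
      exact he.elim
    · rw [actionOf_loc_ne a hu] at h
      cases h
  | comm u u' x d' =>
    by_cases hu : v = u
    · subst hu
      rw [actionOf_comm_left] at h
      cases h
    · by_cases hu' : v = u'
      · subst hu'
        rw [actionOf_comm_right x d' he] at h
        cases h
        rfl
      · rw [actionOf_comm_ne x d' hu hu'] at h
        cases h

theorem Feasible.wf {es : List (Event N)} (h : Feasible P es) : ∀ e ∈ es, e.WF :=
  path_wf h.choose_spec

theorem Feasible.trace {es : List (Event N)} (h : Feasible P es) (v : N) :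
    Trace P v (proj v es) := ⟨es, h, rfl⟩

theorem Trace.path {v : N} {h : List (Action N)} (ht : Trace P v h) :
    ∃ p, Path PStep (P.init v) h p := by
  obtain ⟨es, ⟨s, hs⟩, rfl⟩ := ht
  exact ⟨_, path_proj hs v⟩

theorem FullTrace.path {v : N} {h : List (Action N)} (ht : FullTrace P v h) :
    ∃ p, Path PStep (P.init v) h p ∧ p.pos = .run [] := by
  obtain ⟨es, ⟨s, hs, hf⟩, rfl⟩ := ht
  exact ⟨_, path_proj hs v, hf v⟩

theorem feasible_of_path {es : List (Event N)} (hwf : ∀ e ∈ es, e.WF)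
    (h : ∀ v, ∃ p, Path PStep (P.init v) (proj v es) p) : Feasible P es := by
  choose s hs using h
  exact ⟨s, path_of_proj hwf _ hs⟩

theorem Feasible.loc {es : List (Event N)} (h : Feasible P es) {v : N} {a : Action N}
    (ha : a.IsLocal) (ht : Trace P v (proj v es ++ [a])) : Feasible P (es ++ [.loc v a]) := by
  refine feasible_of_path ?_ fun u => ?_
  · simp only [List.mem_append, List.mem_singleton]
    rintro e (he | rfl)
    · exact h.wf e he
    · exact ha
  · rw [proj_concat]
    by_cases hu : u = v
    · subst hu
      rw [actionOf_loc_self]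
      exact ht.path
    · rw [actionOf_loc_ne a hu, Option.toList_none, List.append_nil]
      exact (h.trace u).path

theorem Feasible.comm {es : List (Event N)} (h : Feasible P es) {v w : N} (hvw : v ≠ w)
    {x : Var N} {d : Val N} (hv : ∃ p, Path PStep (P.init v) (proj v es ++ [.send w d]) p)
    (hw : ∃ p, Path PStep (P.init w) (proj w es ++ [.recv v x d]) p) :
    Feasible P (es ++ [.comm v w x d]) := by
  refine feasible_of_path ?_ fun u => ?_
  · simp only [List.mem_append, List.mem_singleton]
    rintro e (he | rfl)
    · exact h.wf e he
    · exact hvw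
  · rw [proj_concat]
    by_cases hu : u = v
    · subst hu
      rw [actionOf_comm_left]
      exact hv
    · by_cases hu' : u = w
      · subst hu'
        rw [actionOf_comm_right x d hvw]
        exact hw
      · rw [actionOf_comm_ne x d hu hu', Option.toList_none, List.append_nil]
        exact (h.trace u).path

/-- A process that can receive something from `v` can receive whatever `v` can send to it. -/
theorem Trace.recv_of_send {es : List (Event N)} (h : Feasible P es) {v w : N} (hvw : v ≠ w)
    {x : Var N} {d d' : Val N} (hv : Trace P v (proj v es ++ [.send w d]))
    (hw : Trace P w (proj w es ++ [.recv v x d'])) : Trace P w (proj w es ++ [.recv v x d]) := by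
  have hw' : ∃ p, Path PStep (P.init w) (proj w es ++ [.recv v x d]) p := by
    obtain ⟨p, hp⟩ := hw.path
    obtain ⟨q, hq, hs⟩ := Path.concat_iff.1 hp
    obtain ⟨p', hp'⟩ := hs.recv_any d
    exact ⟨p', Path.concat_iff.2 ⟨q, hq, hp'⟩⟩
  have := (h.comm hvw hv.path hw').trace w
  rwa [proj_concat, actionOf_comm_right x d hvw] at this

/-- A process that has finished has no further part in any completion of the execution. -/
theorem fullTrace_of_finished (hP : Terminating P) {es : List (Event N)} {s : SState N}
    (h : Path SStep P.init es s) {v : N} (hv : (s v).pos = .run []) :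
    FullTrace P v (proj v es) := by
  obtain ⟨es', t, ht, hf⟩ := exists_finished hP h
  refine ⟨es ++ es', ⟨t, h.append ht, hf⟩, ?_⟩
  rw [proj_append, (path_of_finished hv (path_proj ht v)).1, List.append_nil]

theorem split_of_proj {v : N} {es : List (Event N)} {a : Action N} {l : List (Action N)}
    (h : proj v es = a :: l) :
    ∃ m e m', es = m ++ e :: m' ∧ proj v m = [] ∧ e.actionOf v = some a := by
  induction es with
  | nil => cases h
  | cons e es ih =>
    rw [proj_cons] at h
    rcases he : e.actionOf v with _ | b
    · rw [he] at h
      obtain ⟨m, e', m', rfl, hm, he'⟩ := ih h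
      exact ⟨e :: m, e', m', rfl, by rw [proj_cons, he, hm]; rfl, he'⟩
    · rw [he] at h
      cases h
      exact ⟨[], e, es, rfl, rfl, he⟩

theorem exists_next (hP : Terminating P) {es : List (Event N)} (h : Feasible P es) {v : N}
    (hv : ¬ FullTrace P v (proj v es)) : ∃ a, Trace P v (proj v es ++ [a]) := by
  obtain ⟨es', hes⟩ := (feasible_iff hP).1 h
  rcases hp : proj v es' with _ | ⟨a, l⟩
  · exact absurd ⟨_, hes, by rw [proj_append, hp, List.append_nil]⟩ hv
  · obtain ⟨m, e, m', rfl, hm, he⟩ := split_of_proj hp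
    refine ⟨a, es ++ m ++ [e], (feasible_iff hP).2 ⟨m', by simpa using hes⟩, ?_⟩
    rw [proj_concat, proj_append, hm, he, List.append_nil]
    rfl

/-- An output to a process that has finished would make proper termination impossible. -/
theorem not_fullTrace_of_send (hP : Terminating P) (hI : P.InCSPin) {es : List (Event N)}
    (h : Feasible P es) {v w : N} (hvw : v ≠ w) {d : Val N}
    (hv : Trace P v (proj v es ++ [.send w d])) : ¬ FullTrace P w (proj w es) := by
  intro hw
  obtain ⟨pv, hpv⟩ := hv.path
  obtain ⟨qv, hqv, hsv⟩ := Path.concat_iff.1 hpv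
  obtain ⟨pw, hpw, hfw⟩ := hw.path
  have key : ∀ u, ∃ p, Path PStep (P.init u) (proj u es) p ∧
      (u = v → ∃ q, PStep p (.send w d) q) ∧ (u = w → p.pos = .run []) := by
    intro u
    by_cases hu : u = v
    · subst hu
      exact ⟨qv, hqv, fun _ => ⟨_, hsv⟩, fun h => absurd h hvw⟩
    · by_cases hu' : u = w
      · subst hu'
        exact ⟨pw, hpw, fun h => absurd h hu, fun _ => hfw⟩
      · obtain ⟨p, hp⟩ := (h.trace u).path
        exact ⟨p, hp, fun h => absurd h hu, fun h => absurd h hu'⟩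
  choose s hs hsv hsw using key
  have hpath := path_of_proj h.wf _ hs
  obtain ⟨q, hq⟩ := hsv v rfl
  obtain ⟨es', t, ht, hf⟩ := exists_finished hP hpath
  have hw' := (path_of_finished (hsw w rfl) (path_proj ht w)).1
  have hv' := path_proj ht v
  rcases hl : proj v es' with _ | ⟨a, l⟩
  · rw [hl, Path.nil_iff] at hv'
    exact no_step_of_finished (hv' ▸ hf v) hq
  · rw [hl] at hv'
    obtain ⟨q', hq', -⟩ := Path.cons_iff.1 hv'
    obtain rfl := eq_of_send hI (hs v) hq hq'
    obtain ⟨m, e, m', rfl, -, he⟩ := split_of_proj hl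
    obtain ⟨x, rfl⟩ := actionOf_eq_send (path_wf ht e (by simp)) he
    rw [proj_append, proj_cons, actionOf_comm_right x d hvw] at hw'
    simp at hw'

theorem Trace.adj_of_send (hA : P.AdmittedBy G') {v w : N} {h : List (Action N)} {d : Val N}
    (ht : Trace P v (h ++ [.send w d])) : G'.Adj v w := by
  obtain ⟨p, hp⟩ := ht.path
  obtain ⟨q, hq, hs⟩ := Path.concat_iff.1 hp
  exact CSP.adj_of_send hA hq hs

theorem Trace.adj_of_recv (hA : P.AdmittedBy G') {v w : N} {h : List (Action N)} {x : Var N}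
    {d : Val N} (ht : Trace P v (h ++ [.recv w x d])) : G'.Adj w v := by
  obtain ⟨p, hp⟩ := ht.path
  obtain ⟨q, hq, hs⟩ := Path.concat_iff.1 hp
  exact CSP.adj_of_recv hA hq hs

/-- A process that has finished has communicated with all processes with which it has to. -/
theorem comm_of_fullTrace {v b : N}
    (hsync : ∀ es, Complete P es → ∃ x d, .comm v b x d ∈ es ∨ .comm b v x d ∈ es)
    {es : List (Event N)} (h : Feasible P es) (hv : FullTrace P v (proj v es)) :
    ∃ x d, .comm v b x d ∈ es ∨ .comm b v x d ∈ es := by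
  obtain ⟨es', hes', heq⟩ := hv
  obtain ⟨x, d, hmem | hmem⟩ := hsync es' hes'
  · have : Action.send b d ∈ proj v es := by
      rw [← heq]
      exact List.mem_filterMap.2 ⟨_, hmem, actionOf_comm_left ..⟩
    obtain ⟨e, he, hev⟩ := List.mem_filterMap.1 this
    obtain ⟨y, rfl⟩ := actionOf_eq_send (h.wf e he) hev
    exact ⟨y, d, Or.inl he⟩
  · have : Action.recv b x d ∈ proj v es := by
      rw [← heq]
      exact List.mem_filterMap.2
        ⟨_, hmem, actionOf_comm_right x d (hes'.feasible.wf _ hmem)⟩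
    obtain ⟨e, he, hev⟩ := List.mem_filterMap.1 this
    obtain rfl := actionOf_eq_recv (h.wf e he) hev
    exact ⟨x, d, Or.inr he⟩

/-! ### The processes that have lost -/

/-- The effect of an event on the set of dead processes: a message from a process that is alive
kills the receiver. -/
def deadStep (D : Set N) : Event N → Set N
  | .loc _ _ => D
  | .comm v w _ _ => D ∪ {u | u = w ∧ v ∉ D}

/-- The set of dead processes after a list of events. -/
def deadSet (V : Set N) (es : List (Event N)) : Set N := es.foldl deadStep Vᶜ

theorem deadSet_concat (es : List (Event N)) (e : Event N) :
    deadSet V (es ++ [e]) = deadStep (deadSet V es) e := by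
  simp [deadSet]

theorem subset_deadStep (D : Set N) (e : Event N) : D ⊆ deadStep D e := by
  cases e with
  | loc => exact subset_rfl
  | comm => exact Set.subset_union_left

theorem compl_subset_deadSet (es : List (Event N)) : Vᶜ ⊆ deadSet V es := by
  induction es using List.reverseRecOn with
  | nil => exact subset_rfl
  | append_singleton es e ih =>
    rw [deadSet_concat]
    exact ih.trans (subset_deadStep _ _)

/-- A process is killed only by a process that is alive and remains so. -/
theorem exists_alive (hV : V.Nonempty) {es : List (Event N)} (hwf : ∀ e ∈ es, e.WF) :
    ∃ v, v ∉ deadSet V es := by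
  induction es using List.reverseRecOn with
  | nil =>
    obtain ⟨v, hv⟩ := hV
    exact ⟨v, fun h => h hv⟩
  | append_singleton es e ih =>
    obtain ⟨v, hv⟩ := ih fun e he => hwf e (by simp [he])
    have he := hwf e (by simp)
    rw [deadSet_concat]
    cases e with
    | loc => exact ⟨v, hv⟩
    | comm a b x d =>
      by_cases ha : a ∈ deadSet V es
      · refine ⟨v, ?_⟩
        rintro (h | ⟨-, h⟩)
        · exact hv h
        · exact h ha
      · refine ⟨a, ?_⟩
        rintro (h | ⟨h, -⟩)
        · exact ha h
        · exact he h

/-- Of two processes that have communicated at most one is alive. -/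
theorem dead_of_comm {es : List (Event N)} {a b : N} {x : Var N} {d : Val N}
    (h : .comm a b x d ∈ es) : a ∈ deadSet V es ∨ b ∈ deadSet V es := by
  induction es using List.reverseRecOn with
  | nil => cases h
  | append_singleton es e ih =>
    rw [deadSet_concat]
    rcases List.mem_append.1 h with h | h
    · exact (ih h).imp (subset_deadStep _ _ ·) (subset_deadStep _ _ ·)
    · obtain rfl := List.mem_singleton.1 h
      by_cases ha : a ∈ deadSet V es
      · exact Or.inl (Or.inl ha)
      · exact Or.inr (Or.inr ⟨rfl, ha⟩)

/-- When some process has finished alive, no other process is alive: it has communicated with all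
processes of `V`. -/
theorem eq_of_alive (hsync : ∀ es, Complete P es → ∀ a ∈ V, ∀ b ∈ V, a ≠ b →
      ∃ x d, .comm a b x d ∈ es ∨ .comm b a x d ∈ es)
    {es : List (Event N)} (h : Feasible P es) {v w : N} (hv : FullTrace P v (proj v es))
    (hv' : v ∉ deadSet V es) (hw' : w ∉ deadSet V es) : v = w := by
  by_contra hvw
  have hvV : v ∈ V := not_not.1 fun hn => hv' (compl_subset_deadSet es hn)
  have hwV : w ∈ V := not_not.1 fun hn => hw' (compl_subset_deadSet es hn)
  obtain ⟨x, d, hm | hm⟩ :=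
    comm_of_fullTrace (fun es hes => hsync es hes v hvV w hwV hvw) h hv
  · exact (dead_of_comm hm).elim hv' hw'
  · exact (dead_of_comm hm).elim hw' hv'

/-! ### Routes -/

/-- In a strongly connected network each process can start a walk through all vertices. -/
theorem exists_route [Finite N] (hconn : ∀ v w, Relation.ReflTransGen G'.Adj v w) (v : N) :
    ∃ r, Route G' v r := by
  classical
  cases nonempty_fintype N
  suffices h : ∀ F : Finset N, ∀ v, ∃ r, (v :: r).IsChain G'.Adj ∧ ∀ u ∈ F, u ≠ v → u ∈ r by
    obtain ⟨r, h₁, h₂⟩ := h Finset.univ v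
    exact ⟨r, h₁, fun u => h₂ u (Finset.mem_univ u)⟩
  intro F
  induction F using Finset.induction_on with
  | empty => exact fun v => ⟨[], by simp, by simp⟩
  | insert w F _ ih =>
    intro v
    obtain ⟨l, hl, hlast⟩ := List.exists_isChain_cons_of_relationReflTransGen (hconn v w)
    obtain ⟨r, hr, hF⟩ := ih w
    refine ⟨l ++ r, ?_, fun u hu huv => ?_⟩
    · rw [← List.cons_append, List.isChain_append]
      refine ⟨hl, hr.tail, fun x hx y hy => ?_⟩
      rw [List.getLast?_eq_getLast_of_ne_nil (List.cons_ne_nil _ _), hlast] at hx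
      obtain rfl : w = x := by simpa using hx
      cases r with
      | nil => simp at hy
      | cons y' r =>
        obtain rfl : y' = y := by simpa using hy
        exact hr.rel
    · have hw : w ≠ v → w ∈ l := fun hwv => by
        have := List.getLast_mem (List.cons_ne_nil v l)
        rw [hlast] at this
        exact (List.mem_cons.1 this).resolve_left hwv
      rw [List.mem_append]
      by_cases huw : u = w
      · exact Or.inl (huw ▸ hw (huw ▸ huv))
      · exact Or.inr (hF u ((Finset.mem_insert.1 hu).resolve_left huw) huw)

end CSP

namespace CSP

variable {N : Type*} {P : System N} {V : Set N} {G' : Digraph N}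

/-! ### Updates of a family of states -/

open Classical in
theorem forall_update {α : Type*} {p : N → α → Prop} {q : N → α} {v : N} {x : α} (hx : p v x)
    (h : ∀ u, u ≠ v → p u (q u)) (u : N) : p u (Function.update q v x u) := by
  by_cases hu : u = v
  · subst hu
    rwa [Function.update_self]
  · rw [Function.update_of_ne hu]
    exact h u hu

open Classical in
theorem sum_update [Fintype N] {α : Type*} (f : α → ℕ) (q : N → α) (v : N) (x : α) :
    ∑ u, f (Function.update q v x u) + f (q v) = ∑ u, f (q u) + f x := by
  have h₁ := Finset.add_sum_erase Finset.univ (fun u => f (Function.update q v x u))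
    (Finset.mem_univ v)
  have h₂ := Finset.add_sum_erase Finset.univ (fun u => f (q u)) (Finset.mem_univ v)
  have h₃ : ∑ u ∈ Finset.univ.erase v, f (Function.update q v x u) =
      ∑ u ∈ Finset.univ.erase v, f (q u) :=
    Finset.sum_congr rfl fun u hu => by rw [Function.update_of_ne (Finset.ne_of_mem_erase hu)]
  simp only [Function.update_self] at h₁
  omega

/-! ### The invariant of the election protocol -/

/-- The process has completed its part of the given system. -/
def Phase.Late : Phase N → Prop
  | .ready => True
  | .halted _ => True
  | _ => False

/-- What a phase of `v` says about its list `h` of actions in the given system and about the set `D`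
of dead processes. -/
def Phase.Agrees (P : System N) (D : Set N) (v : N) : Phase N → List (Action N) → Prop
  | .work h' b, h => h' = h ∧ (b = true ↔ v ∈ D)
  | .commit h' b w d, h => h' = h ∧ (b = true ↔ v ∈ D) ∧ Trace P v (h ++ [.send w d])
  | .wait h' b, h => h' = h ∧ (b = true ↔ v ∈ D) ∧ ¬ FullTrace P v h ∧
      ∀ a, Trace P v (h ++ [a]) → ∃ w x d, a = .recv w x d
  | .ready, h => FullTrace P v h
  | .halted _, h => FullTrace P v h

theorem Phase.Agrees.congr {D D' : Set N} {v : N} {p : Phase N} {h : List (Action N)}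
    (ha : p.Agrees P D v h) (hD : v ∈ D ↔ v ∈ D') : p.Agrees P D' v h := by
  cases p with
  | work | commit | wait =>
    simp only [Agrees] at ha ⊢
    rwa [← hD]
  | ready | halted => exact ha

/-- The state `q` is a state of the protocol after the events `es` of the given system. -/
def Simulates (P : System N) (V : Set N) (q : N → LState N) (es : List (Event N)) : Prop :=
  Feasible P es ∧ ∀ v, (q v).phase.Agrees P (deadSet V es) v (proj v es)

/-- The possible situations of the token, with the number of times it will still be passed on or
consumed: it has not been created and no process has finished alive; it is held by `u` with the
remaining route `r`, which visits all processes that have not stopped; all processes have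
stopped. -/
inductive TokenInv (G' : Digraph N) (D : Set N) (q : N → LState N) : ℕ → Prop
  | absent : (∀ v, (q v).tok = none) → (∀ v l, (q v).phase ≠ .halted l) →
      (∀ v, (q v).phase = .ready → v ∈ D) → TokenInv G' D q 0
  | held (u l : N) (r : List N) : (q u).tok = some (l, r) → (∀ l', (q u).phase ≠ .halted l') →
      (u :: r).IsChain G'.Adj → l ∉ D → (q l).phase.Late → (∀ v, v ≠ u → (q v).tok = none) →
      (∀ v l', v ≠ u → (q v).phase = .halted l' → l' = l ∧ v ∉ r) →
      (∀ v, v ≠ u → (∀ l', (q v).phase ≠ .halted l') → v ∈ r) → TokenInv G' D q (r.length + 1)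
  | finished (l : N) : (∀ v, (q v).phase = .halted l) → TokenInv G' D q 0

theorem TokenInv.mono {D D' : Set N} {q : N → LState N} {t : ℕ} (h : TokenInv G' D q t)
    (hD : D ⊆ D') (hD' : ∀ v, (q v).phase.Late → v ∈ D' → v ∈ D) : TokenInv G' D' q t := by
  cases h with
  | absent h₁ h₂ h₃ => exact .absent h₁ h₂ fun v hv => hD (h₃ v hv)
  | held u l r h₁ h₂ h₃ h₄ h₅ h₆ h₇ h₈ =>
    exact .held u l r h₁ h₂ h₃ (fun h => h₄ (hD' l h₅ h)) h₅ h₆ h₇ h₈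
  | finished l h => exact .finished l h

open Classical in
/-- Steps within the given system, and the completion of this system by a dead process, do not
concern the token. -/
theorem TokenInv.update {D : Set N} {q : N → LState N} {t : ℕ} (h : TokenInv G' D q t) {v : N}
    {x : LState N} (htok : x.tok = (q v).tok) (hv : ¬ (q v).phase.Late)
    (hx : ∀ l, x.phase ≠ .halted l) (hr : x.phase = .ready → v ∈ D) :
    TokenInv G' D (Function.update q v x) t := by
  have hvs : ∀ l, (q v).phase ≠ .halted l := fun l hl => hv (by rw [hl]; trivial)
  have htok' : ∀ u, (Function.update q v x u).tok = (q u).tok :=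
    forall_update (p := fun u (y : LState N) => y.tok = (q u).tok) htok fun _ _ => rfl
  have hhalt : ∀ u l, (Function.update q v x u).phase = .halted l ↔ (q u).phase = .halted l :=
    forall_update (p := fun u (y : LState N) => ∀ l, y.phase = .halted l ↔ (q u).phase = .halted l)
      (fun l => iff_of_false (hx l) (hvs l)) fun _ _ _ => Iff.rfl
  cases h with
  | absent h₁ h₂ h₃ =>
    exact .absent (fun u => (htok' u).trans (h₁ u)) (fun u l => (hhalt u l).not.2 (h₂ u l))
      (forall_update (p := fun u (y : LState N) => y.phase = .ready → u ∈ D) hr fun u _ => h₃ u)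
  | held u l r h₁ h₂ h₃ h₄ h₅ h₆ h₇ h₈ =>
    refine .held u l r ((htok' u).trans h₁) (fun l' => (hhalt u l').not.2 (h₂ l')) h₃ h₄ ?_
      (fun v hv => (htok' v).trans (h₆ v hv))
      (fun v l' hv h => h₇ v l' hv ((hhalt v l').1 h))
      (fun v hv h => h₈ v hv fun l' => (hhalt v l').not.1 (h l'))
    rwa [Function.update_of_ne]
    rintro rfl
    exact hv h₅
  | finished l h => exact absurd (h v) (hvs l)

theorem TokenInv.of_tok {D : Set N} {q : N → LState N} {t : ℕ} {v l : N} {r : List N}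
    (h : TokenInv G' D q t) (hp : (q v).phase = .ready) (htok : (q v).tok = some (l, r)) :
    t = r.length + 1 ∧ (v :: r).IsChain G'.Adj ∧ l ∉ D ∧ (q l).phase.Late ∧
      (∀ u, u ≠ v → (q u).tok = none) ∧
      (∀ u l', u ≠ v → (q u).phase = .halted l' → l' = l ∧ u ∉ r) ∧
      (∀ u, u ≠ v → (∀ l', (q u).phase ≠ .halted l') → u ∈ r) := by
  cases h with
  | absent h₁ =>
    rw [h₁] at htok
    cases htok
  | held u l' r' h₁ h₂ h₃ h₄ h₅ h₆ h₇ h₈ =>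
    by_cases hu : v = u
    · subst hu
      rw [h₁] at htok
      cases htok
      exact ⟨rfl, h₃, h₄, h₅, h₆, h₇, h₈⟩
    · rw [h₆ v hu] at htok
      cases htok
  | finished l' h =>
    rw [h v] at hp
    cases hp

/-- The number of further decisions that a phase allows for without a step of the given system. -/
def Phase.weight : Phase N → ℕ
  | .work _ _ => 2
  | .commit _ _ _ _ => 1
  | .wait _ _ => 1
  | .ready => 0
  | .halted _ => 0

/-- The invariant, with the measure of what remains to be done. The bound `B` for the number of
events of the given system is weighted by `3` as an event may raise the weights of the phases of
two processes by `1` each. -/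
def ElectionInv [Fintype N] (P : System N) (V : Set N) (G' : Digraph N) (B : ℕ)
    (q : N → LState N) (k : ℕ ×ₗ ℕ) : Prop :=
  ∃ es t, Simulates P V q es ∧ TokenInv G' (deadSet V es) q t ∧
    k = toLex (3 * (B - es.length) + ∑ v, (q v).phase.weight, t)

open Classical in
theorem Simulates.update {q : N → LState N} {es : List (Event N)} (h : Simulates P V q es)
    {v : N} {q' : LState N} (h' : q'.phase.Agrees P (deadSet V es) v (proj v es)) :
    Simulates P V (Function.update q v q') es :=
  ⟨h.1, forall_update (p := fun v (q : LState N) => q.phase.Agrees P (deadSet V es) v (proj v es))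
    h' fun u _ => h.2 u⟩

theorem eq_mk {q : LState N} {p : Phase N} (h : q.phase = p) : q = ⟨p, q.tok⟩ := by
  cases q; cases h; rfl

variable [Fintype N] {B : ℕ} {q : N → LState N} {k : ℕ ×ₗ ℕ}

open Classical in
/-- Inner steps of the protocol are possible where they are due, keep the invariant and decrease the
measure. -/
theorem ElectionInv.inner (hP : Terminating P) (hA : P.AdmittedBy G')
    (hB : ∀ es, Feasible P es → es.length ≤ B)
    (hsync : ∀ es, Complete P es → ∀ a ∈ V, ∀ b ∈ V, a ≠ b →
      ∃ x d, .comm a b x d ∈ es ∨ .comm b a x d ∈ es)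
    (hnbr : ∀ v, ∃ w, G'.Adj w v) (hroute : ∀ v, ∃ r, Route G' v r)
    (hinv : ElectionInv P V G' B q k) {v : N} (hm : electionMove P G' v (q v) = .inner) :
    (∃ q', electionInner P G' v (q v) q') ∧
      ∀ q', electionInner P G' v (q v) q' →
        ∃ k' < k, ElectionInv P V G' B (Function.update q v q') k' := by
  obtain ⟨es, t, hsim, htok, rfl⟩ := hinv
  have hv := hsim.2 v
  rcases hph : (q v).phase with ⟨h, b⟩ | ⟨h, b, w, d⟩ | ⟨h, b⟩ | _ | l
  · -- deciding on the next action in the given system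
    rw [hph] at hv
    obtain ⟨rfl, hb⟩ := hv
    rw [eq_mk hph]
    refine ⟨?_, fun q' hq' => ?_⟩
    · by_cases h₁ : ∃ a, a.IsLocal ∧ Trace P v (proj v es ++ [a])
      · obtain ⟨a, ha, ht⟩ := h₁
        exact ⟨_, Or.inl ⟨a, ha, ht, rfl⟩⟩
      by_cases h₂ : ∃ w d, Trace P v (proj v es ++ [.send w d])
      · obtain ⟨w, d, ht⟩ := h₂
        exact ⟨_, Or.inr (Or.inl ⟨w, d, ht, rfl⟩)⟩
      by_cases h₃ : FullTrace P v (proj v es)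
      · cases b with
        | true => exact ⟨_, Or.inr (Or.inr (Or.inl ⟨h₃, rfl, rfl⟩))⟩
        | false =>
          obtain ⟨r, hr⟩ := hroute v
          exact ⟨_, Or.inr (Or.inr (Or.inr (Or.inl ⟨h₃, rfl, r, hr, rfl⟩)))⟩
      · refine ⟨_, Or.inr (Or.inr (Or.inr (Or.inr ⟨fun a ha => ?_, h₃, rfl⟩)))⟩
        cases a with
        | recv w x d => exact ⟨w, x, d, rfl⟩
        | send w d => exact absurd ⟨w, d, ha⟩ h₂
        | skip | assign | guards | exit | choose => exact absurd ⟨_, by trivial, ha⟩ h₁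
    · have hw : ∀ q' : LState N, ∑ u, (Function.update q v q' u).phase.weight + 2 =
          ∑ u, (q u).phase.weight + q'.phase.weight := fun q' => by
        have := sum_update (fun q : LState N => q.phase.weight) q v q'
        rwa [hph] at this
      rcases hq' with ⟨a, ha, ht, rfl⟩ | ⟨w, d, ht, rfl⟩ | ⟨hf, rfl, rfl⟩ | ⟨hf, rfl, r, hr, rfl⟩ |
        ⟨hrecv, hf, rfl⟩
      · have hfe := hsim.1.loc ha ht
        have hD : deadSet V (es ++ [.loc v a]) = deadSet V es := deadSet_concat ..
        refine ⟨_, ?_, es ++ [.loc v a], t, ⟨hfe, ?_⟩, ?_, rfl⟩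
        · have := hw ⟨.work (proj v es ++ [a]) b, (q v).tok⟩
          have hl := hB _ hfe
          rw [List.length_append, List.length_singleton] at hl
          rw [Prod.Lex.toLex_lt_toLex]
          left
          rw [List.length_append, List.length_singleton]
          simp only [Phase.weight] at this ⊢
          omega
        · rw [hD]
          refine forall_update (p := fun u (q : LState N) =>
            q.phase.Agrees P (deadSet V es) u (proj u (es ++ [.loc v a]))) ?_ fun u hu => ?_
          · rw [proj_concat, actionOf_loc_self]
            exact ⟨rfl, hb⟩
          · rw [proj_concat, actionOf_loc_ne a hu, Option.toList_none, List.append_nil]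
            exact hsim.2 u
        · rw [hD]
          exact htok.update rfl (by simp [hph, Phase.Late]) (by simp) (by simp)
      · refine ⟨_, ?_, es, t, hsim.update ⟨rfl, hb, ht⟩, ?_, rfl⟩
        · have := hw ⟨.commit (proj v es) b w d, (q v).tok⟩
          rw [Prod.Lex.toLex_lt_toLex]
          left
          simp only [Phase.weight] at this ⊢
          omega
        · exact htok.update rfl (by simp [hph, Phase.Late]) (by simp) (by simp)
      · refine ⟨_, ?_, es, t, hsim.update hf, ?_, rfl⟩
        · have := hw ⟨.ready, (q v).tok⟩
          rw [Prod.Lex.toLex_lt_toLex]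
          left
          simp only [Phase.weight] at this ⊢
          omega
        · exact htok.update rfl (by simp [hph, Phase.Late]) (by simp) (fun _ => hb.1 rfl)
      · -- a process finishing alive is the first to do so
        have hv' : v ∉ deadSet V es := fun h => by simpa using hb.2 h
        refine ⟨_, ?_, es, r.length + 1, hsim.update hf, ?_, rfl⟩
        · have := hw ⟨.ready, some (v, r)⟩
          rw [Prod.Lex.toLex_lt_toLex]
          left
          simp only [Phase.weight] at this ⊢
          omega
        · cases htok with
          | absent h₁ h₂ h₃ =>
            have hhalt := forall_update (q := q) (v := v) (x := ⟨.ready, some (v, r)⟩)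
              (p := fun _ (x : LState N) => ∀ l, x.phase ≠ .halted l) (by simp)
              fun u _ => h₂ u
            refine .held v v r (by simp) (hhalt v) hr.1 hv' (by simp [Phase.Late]) ?_ ?_ ?_
            · intro u hu
              rw [Function.update_of_ne hu]
              exact h₁ u
            · exact fun u l' _ h => absurd h (hhalt u l')
            · exact fun u hu _ => hr.2 u hu
          | held u l r h₁ h₂ h₃ h₄ h₅ =>
            have := eq_of_alive hsync hsim.1 hf hv' h₄
            subst this
            rw [hph] at h₅
            exact h₅.elim
          | finished l h =>
            rw [h v] at hph
            cases hph
      · refine ⟨_, ?_, es, t, hsim.update ⟨rfl, hb, hf, hrecv⟩, ?_, rfl⟩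
        · have := hw ⟨.wait (proj v es) b, (q v).tok⟩
          rw [Prod.Lex.toLex_lt_toLex]
          left
          simp only [Phase.weight] at this ⊢
          omega
        · exact htok.update rfl (by simp [hph, Phase.Late]) (by simp) (by simp)
  · rw [hph] at hv
    obtain ⟨rfl, -, ht⟩ := hv
    rw [eq_mk hph] at hm
    simp only [electionMove, ht.adj_of_send hA, if_true] at hm
    cases hm
  · rw [hph] at hv
    obtain ⟨rfl, -, hf, hrecv⟩ := hv
    have hne : (sources P G' v (proj v es)).Nonempty := by
      obtain ⟨a, ha⟩ := exists_next hP hsim.1 hf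
      obtain ⟨w, x, d, rfl⟩ := hrecv a ha
      exact ⟨w, ha.adj_of_recv hA, x, d, ha⟩
    rw [eq_mk hph] at hm
    simp only [electionMove, hne, if_true] at hm
    cases hm
  · rw [hph] at hv
    rcases htk : (q v).tok with _ | ⟨l, r⟩
    · obtain ⟨w, hw⟩ := hnbr v
      have hne : {w | G'.Adj w v}.Nonempty := ⟨w, hw⟩
      rw [eq_mk hph, htk] at hm
      simp only [electionMove, hne, if_true] at hm
      cases hm
    · obtain ⟨rfl, h₁, -, -, -, h₂, h₃⟩ := htok.of_tok hph htk
      rw [eq_mk hph, htk] at hm ⊢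
      cases r with
      | cons w r =>
        simp only [electionMove, h₁.rel, if_true] at hm
        cases hm
      | nil =>
        refine ⟨⟨_, l, rfl, rfl⟩, ?_⟩
        rintro q' ⟨l', hl', rfl⟩
        cases hl'
        refine ⟨_, ?_, es, 0, hsim.update hv, .finished l ?_, rfl⟩
        · have := sum_update (fun q : LState N => q.phase.weight) q v ⟨.halted l, none⟩
          rw [hph] at this
          rw [Prod.Lex.toLex_lt_toLex]
          right
          simp only [Phase.weight] at this ⊢
          simp
          omega
        · refine forall_update (p := fun _ (x : LState N) => x.phase = .halted l) rfl fun u hu => ?_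
          by_cases hs : ∃ l', (q u).phase = .halted l'
          · obtain ⟨l', hl'⟩ := hs
            rw [hl', (h₂ u l' hu hl').1]
          · exact absurd (h₃ u hu (not_exists.1 hs)) List.not_mem_nil
  · rw [eq_mk hph] at hm
    cases hm

end CSP

namespace CSP

variable {N : Type*} {P : System N} {V : Set N} {G' : Digraph N}

/-! ### Communications and deadlocks of the election protocol -/

theorem electionMove_send {v w : N} {q : LState N} {m : Val N}
    (h : electionMove P G' v q = .send w m) :
    (∃ h b d, q.phase = .commit h b w d ∧ m = dataMsg (!b) d) ∨
      ∃ l r, q.phase = .ready ∧ q.tok = some (l, w :: r) ∧ m = tokMsg l r := by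
  obtain ⟨_ | ⟨h', b, w', d⟩ | _ | _ | _, _ | ⟨l, _ | ⟨w', r⟩⟩⟩ := q <;>
    simp only [electionMove] at h <;> (try split_ifs at h) <;> cases h
  · exact Or.inl ⟨_, _, _, rfl, rfl⟩
  · exact Or.inl ⟨_, _, _, rfl, rfl⟩
  · exact Or.inl ⟨_, _, _, rfl, rfl⟩
  · exact Or.inr ⟨_, _, rfl, rfl, rfl⟩

theorem electionMove_listen {v : N} {q : LState N} {L : Set N}
    (h : electionMove P G' v q = .listen L) :
    (∃ h b, q.phase = .wait h b ∧ L = sources P G' v h) ∨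
      q.phase = .ready ∧ q.tok = none := by
  obtain ⟨_ | _ | ⟨h', b⟩ | _ | _, _ | ⟨l, _ | ⟨w', r⟩⟩⟩ := q <;>
    simp only [electionMove] at h <;> (try split_ifs at h) <;> cases h
  · exact Or.inl ⟨_, _, rfl, rfl⟩
  · exact Or.inl ⟨_, _, rfl, rfl⟩
  · exact Or.inl ⟨_, _, rfl, rfl⟩
  · exact Or.inr ⟨rfl, rfl⟩

variable [Fintype N] {B : ℕ} {q : N → LState N} {k : ℕ ×ₗ ℕ}

open Classical in
/-- Communications of the protocol keep the invariant and decrease the measure. -/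
theorem ElectionInv.comm (hP : Terminating P) (hI : P.InCSPin)
    (hB : ∀ es, Feasible P es → es.length ≤ B) (hinv : ElectionInv P V G' B q k) {v w : N}
    (hvw : v ≠ w) {m : Val N} {L : Set N} (hm : electionMove P G' v (q v) = .send w m)
    (hL : electionMove P G' w (q w) = .listen L) (hv : v ∈ L) :
    (∃ q', electionRecv P w (q w) v m q') ∧
      ∀ q', electionRecv P w (q w) v m q' → ∃ k' < k, ElectionInv P V G' B
        (Function.update (Function.update q v (electionSent v (q v))) w q') k' := by
  obtain ⟨es, t, hsim, htok, rfl⟩ := hinv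
  have hav := hsim.2 v
  have haw := hsim.2 w
  have hsum : ∀ x y : LState N,
      ∑ u, (Function.update (Function.update q v x) w y u).phase.weight + (q v).phase.weight +
        (q w).phase.weight = ∑ u, (q u).phase.weight + x.phase.weight + y.phase.weight := by
    intro x y
    have h₁ := sum_update (fun q : LState N => q.phase.weight) (Function.update q v x) w y
    have h₂ := sum_update (fun q : LState N => q.phase.weight) q v x
    rw [Function.update_of_ne hvw.symm] at h₁
    omega
  rcases electionMove_send hm with ⟨h, b, d, hph, rfl⟩ | ⟨l, r, hph, htk, rfl⟩
  · -- a message of the given system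
    rw [hph] at hav
    obtain ⟨rfl, hb, hsend⟩ := hav
    rcases electionMove_listen hL with ⟨h, b', hphw, rfl⟩ | ⟨hphw, -⟩
    · rw [hphw] at haw
      obtain ⟨rfl, hb', hf, hrecv⟩ := haw
      obtain ⟨-, x, d', hx⟩ := hv
      refine ⟨⟨_, Or.inr ⟨_, b', !b, d, x, rfl, hphw, .recv_of_send hsim.1 hvw hsend hx, rfl⟩⟩, ?_⟩
      rintro q' (⟨l, r, he, -⟩ | ⟨h, b₂, alive, d₂, x, he, hphw', ht, rfl⟩)
      · simp [tokMsg, dataMsg] at he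
      obtain ⟨rfl, rfl⟩ : (!b) = alive ∧ d = d₂ := by simpa [dataMsg] using he
      rw [hphw] at hphw'
      cases hphw'
      have hfe := hsim.1.comm hvw hsend.path ht.path
      have hD : ∀ u, u ∈ deadSet V (es ++ [.comm v w x d]) ↔
          u ∈ deadSet V es ∨ u = w ∧ v ∉ deadSet V es := by
        intro u
        rw [deadSet_concat]
        exact Iff.rfl
      have hsent : electionSent v (q v) =
          ⟨.work (proj v es ++ [.send w d]) b, (q v).tok⟩ := by
        rw [eq_mk hph]
        rfl
      rw [hsent]
      refine ⟨_, ?_, es ++ [.comm v w x d], t, ⟨hfe, ?_⟩, ?_, rfl⟩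
      · have := hsum ⟨.work (proj v es ++ [.send w d]) b, (q v).tok⟩
          ⟨.work (proj w es ++ [.recv v x d]) (b' || !b), (q w).tok⟩
        rw [hph, hphw] at this
        have hl := hB _ hfe
        rw [List.length_append, List.length_singleton] at hl
        rw [Prod.Lex.toLex_lt_toLex]
        left
        rw [List.length_append, List.length_singleton]
        simp only [Phase.weight] at this ⊢
        omega
      · refine forall_update (p := fun u (q : LState N) => q.phase.Agrees P
          (deadSet V (es ++ [.comm v w x d])) u (proj u (es ++ [.comm v w x d]))) ?_ fun u hu => ?_
        · rw [proj_concat, actionOf_comm_right x d hvw]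
          refine ⟨rfl, ?_⟩
          rw [hD, ← hb, ← hb']
          cases b <;> simp
        · revert hu
          refine forall_update (p := fun u (q : LState N) => u ≠ w → q.phase.Agrees P
            (deadSet V (es ++ [.comm v w x d])) u (proj u (es ++ [.comm v w x d]))) ?_ ?_ u
          · rw [proj_concat, actionOf_comm_left]
            intro _
            refine ⟨rfl, ?_⟩
            rw [hD, ← hb]
            simp [hvw]
          · intro u hu hu'
            rw [proj_concat, actionOf_comm_ne x d hu hu', Option.toList_none, List.append_nil]
            refine (hsim.2 u).congr ?_
            rw [hD]
            simp [hu']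
      · have h₁ : TokenInv G' (deadSet V (es ++ [.comm v w x d])) q t := htok.mono ?_ ?_
        · have h₂ := h₁.update (v := v) (x := ⟨.work (proj v es ++ [.send w d]) b, (q v).tok⟩) rfl
            (by simp [hph, Phase.Late]) (by simp) (by simp)
          refine h₂.update (v := w)
            (x := ⟨.work (proj w es ++ [.recv v x d]) (b' || !b), (q w).tok⟩) ?_ ?_
            (by simp) (by simp)
          · rw [Function.update_of_ne hvw.symm]
          · rw [Function.update_of_ne hvw.symm, hphw]
            exact id
        · exact fun u hu => (hD u).2 (Or.inl hu)
        · intro u hu hu'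
          refine ((hD u).1 hu').resolve_right ?_
          rintro ⟨rfl, -⟩
          rw [hphw] at hu
          exact hu
    · rw [hphw] at haw
      exact absurd haw (not_fullTrace_of_send hP hI hsim.1 hvw hsend)
  · -- the token is passed on
    obtain ⟨rfl, h₁, h₂, h₃, h₄, h₅, h₆⟩ := htok.of_tok hph htk
    have hw : (∃ h b, (q w).phase = .wait h b) ∨ (q w).phase = .ready := by
      rcases electionMove_listen hL with ⟨h, b', hphw, -⟩ | ⟨hphw, -⟩
      · exact Or.inl ⟨_, _, hphw⟩
      · exact Or.inr hphw
    refine ⟨⟨_, Or.inl ⟨l, r, rfl, hw, rfl⟩⟩, ?_⟩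
    rintro q' (⟨l', r', he, -, rfl⟩ | ⟨h, b₂, alive, d₂, x, he, -⟩)
    swap
    · simp [tokMsg, dataMsg] at he
    obtain ⟨rfl, rfl⟩ := tokMsg_inj.1 he
    have hws : ∀ l', (q w).phase ≠ .halted l' := by
      rcases hw with ⟨h, b, hw⟩ | hw <;> simp [hw]
    have hsent : electionSent v (q v) =
        if v ∈ r then ⟨.ready, none⟩ else ⟨.halted l, none⟩ := by
      rw [eq_mk hph, htk]
      rfl
    have hphase : (electionSent v (q v)).phase = if v ∈ r then .ready else .halted l := by
      rw [hsent]
      split_ifs <;> rfl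
    have hlate : (electionSent v (q v)).phase.Late := by
      rw [hphase]
      split_ifs <;> trivial
    rw [hph] at hav
    refine ⟨_, ?_, es, r.length + 1, ⟨hsim.1, ?_⟩, ?_, rfl⟩
    · have := hsum (electionSent v (q v)) ⟨(q w).phase, some (l, r)⟩
      have h₀ : (electionSent v (q v)).phase.weight = 0 := by
        rw [hphase]
        split_ifs <;> rfl
      rw [hph, h₀] at this
      rw [Prod.Lex.toLex_lt_toLex]
      right
      simp only [Phase.weight, List.length_cons] at this ⊢
      omega
    · refine forall_update (p := fun u (q : LState N) => q.phase.Agrees P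
        (deadSet V es) u (proj u es)) haw fun u _ => ?_
      refine forall_update (p := fun u (q : LState N) => q.phase.Agrees P
        (deadSet V es) u (proj u es)) ?_ (fun u _ => hsim.2 u) u
      rw [hphase]
      split_ifs <;> exact hav
    · have hupd : ∀ u, u ≠ w → Function.update (Function.update q v (electionSent v (q v))) w
          ⟨(q w).phase, some (l, r)⟩ u = Function.update q v (electionSent v (q v)) u :=
        fun u hu => Function.update_of_ne hu ..
      refine .held w l r (by simp) (by simpa using hws) h₁.tail h₂ ?_ ?_ ?_ ?_
      · refine forall_update (p := fun u (q : LState N) => u = l → q.phase.Late)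
          (fun h => by rw [h]; exact h₃) (fun u _ => ?_) l rfl
        exact forall_update (p := fun u (q : LState N) => u = l → q.phase.Late)
          (fun _ => hlate) (fun u _ h => by rw [h]; exact h₃) u
      · intro u hu
        rw [hupd u hu]
        refine forall_update (p := fun _ (q : LState N) => q.tok = none) ?_ (fun u hu => h₄ u hu) u
        rw [hsent]
        split_ifs <;> rfl
      · intro u l' hu
        rw [hupd u hu]
        refine forall_update (p := fun u (q : LState N) => q.phase = .halted l' →
          l' = l ∧ u ∉ r) ?_ (fun u hu h => ?_) u
        · rw [hphase]
          split_ifs with hr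
          · simp
          · intro h
            cases h
            exact ⟨rfl, hr⟩
        · obtain ⟨h, h'⟩ := h₅ u l' hu h
          exact ⟨h, fun hm => h' (List.mem_cons_of_mem _ hm)⟩
      · intro u hu
        rw [hupd u hu]
        revert hu
        refine forall_update (p := fun u (q : LState N) => u ≠ w →
          (∀ l', q.phase ≠ .halted l') → u ∈ r) ?_ (fun u hu hu' h => ?_) u
        · rw [hphase]
          split_ifs with hr
          · exact fun _ _ => hr
          · exact fun _ h => absurd rfl (h l)
        · exact (List.mem_cons.1 (h₆ u hu h)).resolve_left hu'

/-- Where no step of the protocol is possible all processes have stopped: while some process is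
executing the given system, a deadlock of the protocol would be a deadlock of that system; and later
the token can be passed on. -/
theorem ElectionInv.stuck (hP : Terminating P) (hA : P.AdmittedBy G') (hI : P.InCSPin)
    (hV : V.Nonempty) (hloop : ∀ v, ¬ G'.Adj v v)
    (hinv : ElectionInv P V G' B q k) (hinner : ∀ v, electionMove P G' v (q v) ≠ .inner)
    (hcomm : ∀ v w m L, v ≠ w → electionMove P G' v (q v) = .send w m →
      electionMove P G' w (q w) = .listen L → v ∉ L) :
    ∃ l, ∀ v, electionMove P G' v (q v) = .halt l := by
  obtain ⟨es, t, hsim, htok, rfl⟩ := hinv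
  have hlate : ∀ v, (q v).phase.Late := by
    -- a state of the given system in which each process is as its phase says
    have key : ∀ v, ∃ p, Path PStep (P.init v) (proj v es) p ∧
        (∀ h b w d, (q v).phase = .commit h b w d → ∃ p', PStep p (.send w d) p') ∧
        (∀ h b, (q v).phase = .wait h b → p.pos ≠ .run []) ∧
        ((q v).phase.Late → p.pos = .run []) := by
      intro v
      have hv := hsim.2 v
      rcases hph : (q v).phase with ⟨h, b⟩ | ⟨h, b, w, d⟩ | ⟨h, b⟩ | _ | l <;> rw [hph] at hv
      · exact absurd (by rw [eq_mk hph]; rfl) (hinner v)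
      · obtain ⟨rfl, -, ht⟩ := hv
        obtain ⟨p, hp⟩ := ht.path
        obtain ⟨p', hp', hs⟩ := Path.concat_iff.1 hp
        refine ⟨p', hp', ?_, by simp, fun h => h.elim⟩
        rintro _ _ _ _ ⟨⟩
        exact ⟨_, hs⟩
      · obtain ⟨rfl, -, hf, -⟩ := hv
        obtain ⟨s, hs⟩ := hsim.1
        exact ⟨s v, path_proj hs v, by simp,
          fun _ _ _ h => hf (fullTrace_of_finished hP hs h), fun h => h.elim⟩
      · obtain ⟨p, hp, hfin⟩ := FullTrace.path hv
        exact ⟨p, hp, by simp, by simp, fun _ => hfin⟩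
      · obtain ⟨p, hp, hfin⟩ := FullTrace.path hv
        exact ⟨p, hp, by simp, by simp, fun _ => hfin⟩
    choose s hs hcom hwait hfin using key
    have hpath := path_of_proj hsim.1.wf _ hs
    by_cases hst : Stuck s
    · have hf := hst.finished hP hpath
      intro v
      rcases hph : (q v).phase with ⟨h, b⟩ | ⟨h, b, w, d⟩ | ⟨h, b⟩ | _ | l
      · exact absurd (by rw [eq_mk hph]; rfl) (hinner v)
      · obtain ⟨p', hp'⟩ := hcom v _ _ _ _ hph
        exact absurd hp' (no_step_of_finished (hf v))
      · exact absurd (hf v) (hwait v _ _ hph)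
      · trivial
      · trivial
    · exfalso
      simp only [Stuck, not_forall, not_not] at hst
      obtain ⟨e, t', he⟩ := hst
      have hfe : Feasible P (es ++ [e]) := ⟨_, hpath.append (.single he)⟩
      have next : ∀ v a, e.actionOf v = some a → Trace P v (proj v es ++ [a]) := by
        intro v a ha
        have := hfe.trace v
        rwa [proj_concat, ha] at this
      -- a process with a step other than an input is committed to this step
      have hcase : ∀ v a p', PStep (s v) a p' → e.actionOf v = some a →
          (∃ h b w d, (q v).phase = .commit h b w d ∧ a = .send w d) ∨
          ∃ h b w x d, (q v).phase = .wait h b ∧ a = .recv w x d := by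
        intro v a p' hp' ha
        have hv := hsim.2 v
        rcases hph : (q v).phase with ⟨h, b⟩ | ⟨h, b, w, d⟩ | ⟨h, b⟩ | _ | l
        · exact absurd (by rw [eq_mk hph]; rfl) (hinner v)
        · obtain ⟨p'', hp''⟩ := hcom v _ _ _ _ hph
          exact Or.inl ⟨h, b, w, d, rfl, eq_of_send hI (hs v) hp'' hp'⟩
        · rw [hph] at hv
          obtain ⟨rfl, -, -, hr⟩ := hv
          obtain ⟨w, x, d, rfl⟩ := hr a (next v a ha)
          exact Or.inr ⟨_, b, w, x, d, rfl, rfl⟩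
        · exact absurd hp' (no_step_of_finished (hfin v (by rw [hph]; trivial)))
        · exact absurd hp' (no_step_of_finished (hfin v (by rw [hph]; trivial)))
      cases he with
      | loc v a p ha hp =>
        rcases hcase v a p hp (actionOf_loc_self v a) with ⟨_, _, _, _, -, rfl⟩ |
          ⟨_, _, _, _, _, -, rfl⟩ <;> exact ha
      | comm v w x d p p' hvw hp hp' =>
        rcases hcase v _ p hp (actionOf_comm_left ..) with ⟨h, b, w', d', hph, h'⟩ |
          ⟨_, _, _, _, _, -, h'⟩
        swap
        · cases h'
        cases h'
        rcases hcase w _ p' hp' (actionOf_comm_right x d hvw) with ⟨_, _, _, _, -, h'⟩ |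
          ⟨h₂, b₂, w₂, x₂, d₂, hph₂, h'⟩
        · cases h'
        cases h'
        have hrecv := next w _ (actionOf_comm_right x d hvw)
        have hadj := hrecv.adj_of_recv hA
        have hw := hsim.2 w
        rw [hph₂] at hw
        obtain ⟨rfl, -⟩ := hw
        have hsrc : v ∈ sources P G' w (proj w es) := ⟨hadj, x, d, hrecv⟩
        refine hcomm v w (dataMsg (!b) d) (sources P G' w (proj w es)) hvw ?_ ?_ hsrc
        · rw [eq_mk hph]
          exact if_pos hadj
        · rw [eq_mk hph₂]
          exact if_pos ⟨v, hsrc⟩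
  have hphase : ∀ v, (q v).phase = .ready ∨ ∃ l, (q v).phase = .halted l := by
    intro v
    have := hlate v
    rcases hph : (q v).phase with ⟨h, b⟩ | ⟨h, b, w, d⟩ | ⟨h, b⟩ | _ | l
    · exact (hph ▸ this).elim
    · exact (hph ▸ this).elim
    · exact (hph ▸ this).elim
    · exact Or.inl rfl
    · exact Or.inr ⟨l, rfl⟩
  cases htok with
  | absent h₁ h₂ h₃ =>
    obtain ⟨v, hv⟩ := exists_alive hV hsim.1.wf
    exact absurd (h₃ v ((hphase v).resolve_right fun ⟨l, h⟩ => h₂ v l h)) hv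
  | held u l r h₁ h₂ h₃ h₄ h₅ h₆ h₇ h₈ =>
    exfalso
    have hu := (hphase u).resolve_right fun ⟨l, h⟩ => h₂ l h
    cases r with
    | nil =>
      refine hinner u ?_
      rw [eq_mk hu, h₁]
      rfl
    | cons w r =>
      have hadj : G'.Adj u w := h₃.rel
      have hwu : w ≠ u := fun h => hloop u (h ▸ hadj)
      have hw := (hphase w).resolve_right fun ⟨l', h⟩ =>
        (h₇ w l' hwu h).2 List.mem_cons_self
      refine hcomm u w (tokMsg l r) {u | G'.Adj u w} hwu.symm ?_ ?_ hadj
      · rw [eq_mk hu, h₁]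
        exact if_pos hadj
      · rw [eq_mk hw, h₆ w hwu]
        exact if_pos ⟨u, hadj⟩
  | finished l h =>
    refine ⟨l, fun v => ?_⟩
    rw [eq_mk (h v)]
    rfl

theorem electionInv_init : ElectionInv P V G' B (election P V G').init
    (toLex (3 * B + ∑ v, ((election P V G').init v).phase.weight, 0)) := by
  refine ⟨[], 0, ⟨⟨_, .nil _⟩, fun v => ⟨rfl, ?_⟩⟩, .absent (fun _ => rfl) ?_ ?_, rfl⟩
  · simp [deadSet]
  · simp [election]
  · simp [election]

end CSP

/-! ### The network and its symmetries -/

namespace Network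

variable {N : Type*} {V : Set N} {G : Digraph V} {G' : Digraph N} {S : V → Set N}

theorem IsSymmExtension.reflTransGen (hG' : IsSymmExtension V G G' S)
    (hG : ∀ a b, StronglyConn G a b) (x y : N) : Relation.ReflTransGen G'.Adj x y := by
  have hconn : ∀ v, ∀ x ∈ S v, StronglyConn G' v x := by
    intro v x hx
    by_cases h : x = v
    · subst h
      exact ⟨.refl, .refl⟩
    · exact hG'.conn v x hx h
  have hmain : ∀ v w : V, Relation.ReflTransGen G'.Adj (v : N) w := by
    intro v w
    induction (hG v w).1 with
    | refl => exact .refl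
    | @tail a b _ hab ih =>
      by_cases h : a = b
      · exact h ▸ ih
      · obtain ⟨x, hx, y, hy, hxy⟩ := (hG'.inter a b h).2 hab
        exact ((ih.trans (hconn a x hx).1).tail hxy).trans (hconn b y hy).2
  obtain ⟨v, hv, -⟩ := hG'.partition x
  obtain ⟨w, hw, -⟩ := hG'.partition y
  exact ((hconn v x hv).2.trans (hmain v w)).trans (hconn w y hw).1

theorem Respects.one : Respects V S 1 := by
  refine ⟨by simp, fun v w h => ?_⟩
  obtain rfl : v = w := Subtype.ext h
  simp

theorem Respects.mul {σ τ : Equiv.Perm N} (hσ : Respects V S σ) (hτ : Respects V S τ) :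
    Respects V S (σ * τ) := by
  constructor
  · rw [Equiv.Perm.coe_mul, Set.image_comp, hτ.1, hσ.1]
  · intro v w h
    have hu : τ v ∈ V := hτ.1.subset (Set.mem_image_of_mem τ v.2)
    rw [Equiv.Perm.coe_mul, Set.image_comp, hτ.2 v ⟨τ v, hu⟩ rfl]
    exact hσ.2 _ _ h

variable (V G' S) in
/-- The group of the symmetries that a system is required to have. -/
def symmetries [Finite N] : Subgroup (Equiv.Perm N) :=
  have hmul : ∀ {σ τ : Equiv.Perm N}, IsAut G' σ ∧ Respects V S σ → IsAut G' τ ∧ Respects V S τ →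
      IsAut G' (σ * τ) ∧ Respects V S (σ * τ) := fun hσ hτ =>
    ⟨fun v w h => hσ.1 _ _ (hτ.1 v w h), hσ.2.mul hτ.2⟩
  have hone : IsAut G' 1 ∧ Respects V S 1 := ⟨fun _ _ h => h, .one⟩
  { carrier := {σ | IsAut G' σ ∧ Respects V S σ}
    one_mem' := hone
    mul_mem' := hmul
    inv_mem' := by
      intro σ hσ
      -- in a finite group the inverse is a power
      obtain ⟨n, hn, h⟩ := (isOfFinOrder_of_finite σ).exists_pow_eq_one
      have hpow : ∀ m, IsAut G' (σ ^ m) ∧ Respects V S (σ ^ m) := fun m => by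
        induction m with
        | zero => exact hone
        | succ m ih => exact pow_succ σ m ▸ hmul ih hσ
      obtain ⟨m, rfl⟩ := Nat.exists_eq_succ_of_ne_zero hn.ne'
      rw [← eq_inv_of_mul_eq_one_left ((pow_succ σ m).symm.trans h)]
      exact hpow m }

end Network

namespace CSP

variable {N : Type*} {P : System N} {V : Set N}

theorem System.Synchronizes.terminating (h : P.Synchronizes V) : Terminating P := fun C => (h C).1

theorem System.Synchronizes.exists_comm (h : P.Synchronizes V) {es : List (Event N)}
    (hes : Complete P es) {a b : N} (ha : a ∈ V) (hb : b ∈ V) (hab : a ≠ b) :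
    ∃ x d, .comm a b x d ∈ es ∨ .comm b a x d ∈ es := by
  obtain ⟨t, ht, hf⟩ := hes
  obtain ⟨C, hC, -⟩ := exists_computation ht hf.stuck
  obtain ⟨n, x, d, hn⟩ := (h C).2 a ha b hb hab
  rw [hC] at hn
  exact ⟨x, d, hn.imp List.mem_of_getElem? List.mem_of_getElem?⟩

theorem System.IsElectoral.terminating (h : P.IsElectoral) : Terminating P := fun C =>
  let ⟨n, hn, hf, _⟩ := h C
  ⟨n, hn, hf⟩

end CSP

/-! ### The electoral system -/

theorem mainTheorem6 {N : Type*} [Finite N] (V : Set N) (G : Digraph V)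
    (hG : Network.IsPeerToPeer G) (G' : Digraph N) (S : V → Set N)
    (hG' : Network.IsSymmExtension V G G' S)
    (hsync : ∃ P : CSP.System N, P.AdmittedBy G' ∧ P.InCSPin ∧ P.IsGSymmetric V G' S ∧
      P.Synchronizes V) :
    ∃ P : CSP.System N, P.AdmittedBy G' ∧ P.InCSPin ∧ P.IsGSymmetric V G' S ∧
      P.IsElectoral := by
  obtain ⟨P, hA, hI, hsym, hs⟩ := hsync
  cases nonempty_fintype N
  have hP := hs.terminating
  have hconn := hG'.reflTransGen hG.strongly_connected
  obtain ⟨a, b, hab⟩ := hG.two_vertices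
  have hnbr : ∀ v, ∃ w, G'.Adj w v := by
    intro v
    obtain ⟨u, hu⟩ : ∃ u : N, u ≠ v := by
      by_cases ha : (a : N) = v
      · exact ⟨b, fun hb => hab (Subtype.ext (ha.trans hb.symm))⟩
      · exact ⟨a, ha⟩
    rcases Relation.ReflTransGen.cases_tail (hconn u v) with h | ⟨w, -, hw⟩
    · exact absurd h.symm hu
    · exact ⟨w, hw⟩
  obtain ⟨B, hB⟩ := CSP.exists_length_bound (CSP.acc_init hP)
  have hM : (CSP.election P V G').IsSymm (Network.symmetries V G' S) :=
    CSP.election_isSymm hP (fun σ hσ es => CSP.complete_rename hP hsym hσ.1 hσ.2)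
      (fun σ hσ => hσ.1) fun σ hσ v hv => hσ.2.1 ▸ Set.mem_image_of_mem σ hv
  have hfit := CSP.election_fits P V G'
  have henc := CSP.encState_injective (N := N)
  have hel : ((CSP.election P V G').toSystem CSP.encState
      (Network.symmetries V G' S) G').IsElectoral :=
    CSP.Machine.toSystem_isElectoral henc hfit hM (CSP.ElectionInv P V G' B)
      ⟨_, CSP.electionInv_init⟩
      (fun q k v hinv => hinv.inner hP hA (fun es ⟨s, h⟩ => hB es s h)
        (fun es hes a ha b hb hab => hs.exists_comm hes ha hb hab) hnbr (CSP.exists_route hconn))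
      (fun q k v w m L hinv hvw hm hL hv =>
        hinv.comm hP hI (fun es ⟨s, h⟩ => hB es s h) hvw hm hL hv)
      (fun q k hinv => hinv.stuck hP hA hI ⟨a, a.2⟩ hG'.loopless)
  exact ⟨_, CSP.Machine.toSystem_admittedBy _ _ _ _, CSP.Machine.toSystem_inCSPin _ _ _ _,
    CSP.isGSymmetric_of_complete_rename hel.terminating fun σ h₁ h₂ es =>
      CSP.Machine.complete_rename_toSystem henc hfit hM CSP.encState_smul ⟨h₁, h₂⟩, hel⟩
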